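/- **Setting.** Consider $\min_{x\in\mathbb R^d}\psi_0(x)=f_0(x)+\chi_0(x)$ subject to $\psi_i(x)=f_i(x)+\chi_i(x)\le\eta_i$, $i=1,\dots,m$, where $\chi_0:\mathbb R^d\to(-\infty,\infty]$ is proper, convex and lower semicontinuous, $\chi_1,\dots,\chi_m$ are real-valued, convex and continuous on $\operatorname{dom}\chi_0$, each $f_i$ ($0\le i\le m$) is differentiable with $L_i$-Lipschitz gradient on $\operatorname{dom}\chi_0$, and the feasible set $\{x\in\operatorname{dom}\chi_0:\psi_i(x)\le\eta_i,\ 1\le i\le m\}$ is compact. Put $\partial\psi_i(x)=\{\nabla f_i(x)\}+\partial\chi_i(x)$, where for $i\ge1$ the function $\chi_i$ is regarded as a convex function with domain $\operatorname{dom}\chi_0$ (value $+\infty$ outside). In sums $\sum_i\lambda_i\,\partial(\cdot)$ below, terms with $\lambda_i=0$ are $\{0\}$. A feasible point $x$ is a *KKT point* if there is $\lambda\in\mathbb R^m_+$ with $0\in\partial\psi_0(x)+\sum_{i=1}^m\lambda_i\partial\psi_i(x)$ and $\sum_{i=1}^m\lambda_i(\psi_i(x)-\eta_i)=0$. A point $x$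 satisfies *MFCQ* if there is $z\in -N^*_{\operatorname{dom}\chi_0}(x)$ (minus the dual cone of the normal cone) with $\langle v,z\rangle<0$ for all $v\in\partial\psi_i(x)$ and all $i\geq 1$ with $\psi_i(x)=\eta_i$. *Uniform MFCQ* means that all feasible points satisfy MFCQ. Let $f_0(x)=\mathbb E[F(x,\xi)]$ with $\xi\sim P$ and $F(\cdot,\xi)$ differentiable, and suppose that for some $\sigma\in(0,\infty)$ and all $x\in\operatorname{dom}\chi_0$, $\mathbb E[\nabla F(x,\xi)]=\nabla f_0(x)$ and $\mathbb E\|\nabla F(x,\xi)-\nabla f_0(x)\|^2\le\sigma^2$. **Algorithm LCSPG.** Let $x^0\in\operatorname{dom}\chi_0$ and $\eta^0\in\mathbb R^m$ satisfy $\psi_i(x^0)<\eta^0_i<\eta_i$ for all $i\ge1$. For $k=0,1,2,\dots$, given batch sizes $b_k\ge1$, parameters $\gamma_k$ and increments $\delta^k_i>0$ with $\eta^{k+1}_i=\eta^k_i+\delta^k_i<\eta_i$ and $\lim_k\eta^k_i=\eta_i$: draw $b_k$ samples $\xi_{1,k},\dots,\xi_{b_k,k}$ from $P$ (all samples of all iterations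 being independent), put $G^k=\frac1{b_k}\sum_{i=1}^{b_k}\nabla F(x^k,\xi_{i,k})$, and let $x^{k+1}$ be the solution of $$\min_x\ \psi^k_0(x)=\langle G^k,x\rangle+\tfrac{\gamma_k}2\|x-x^k\|^2+\chi_0(x)\quad\text{s.t.}\quad \psi^k_i(x)=f_i(x^k)+\langle\nabla f_i(x^k),x-x^k\rangle+\tfrac{L_i}2\|x-x^k\|^2+\chi_i(x)\le\eta^k_i,\ 1\le i\le m.$$ A multiplier vector of this subproblem is a $\lambda^{k+1}\in\mathbb R^m_+$ with $0\in\partial\psi_0^k(x^{k+1})+\sum_{i=1}^m\lambda_i^{k+1}\partial\psi_i^k(x^{k+1})$ and $\lambda_i^{k+1}(\psi_i^k(x^{k+1})-\eta_i^k)=0$ for all $i\ge1$. **Theorem.** Suppose that $\sum_{k\ge0}b_k^{-1}<\infty$ and that there are real numbers $\beta_k$, bounded below by a positive constant, with $2\gamma_k-\beta_k-L_0>0$ for all $k$. Then $\lim_{k\to\infty}\|x^{k+1}-x^k\|=0$ almost surely. If, moreover, uniform MFCQ holds and $\sup_k\gamma_k<\infty$, then 1. almost surely, multiplier vectors $\lambda^{k+1}$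 exist for all $k\ge0$, and $\sup_{k\geq 0}\|\lambda^{k+1}\|<\infty$ for every choice of them; 2. almost surely, every limit point of $(x^k)$ is a KKT point of the problem. -/

import Mathlib

open MeasureTheory ProbabilityTheory Filter Topology

noncomputable section

namespace LevelConstrained

/-- The Euclidean space `ℝ^d`. -/
abbrev Vec (d : ℕ) : Type := EuclideanSpace ℝ (Fin d)

/-! ### Convex analysis of extended-valued functions -/

/-- Effective domain of an extended-valued function. -/
def effDom {d : ℕ} (g : Vec d → EReal) : Set (Vec d) := {x | g x ≠ ⊤}

/-- Proper, convex (convex epigraph) and lower semicontinuous extended-valued function. -/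
structure IsProperConvexLsc {d : ℕ} (g : Vec d → EReal) : Prop where
  ne_bot : ∀ x, g x ≠ ⊥
  dom_nonempty : (effDom g).Nonempty
  convex_epigraph : Convex ℝ {p : Vec d × ℝ | g p.1 ≤ (p.2 : EReal)}
  lsc : LowerSemicontinuous g

open Classical in
/-- A real function given on `D`, regarded as an extended-valued function on the whole space
with the value `+∞` outside `D`. -/
def extendTop {d : ℕ} (D : Set (Vec d)) (g : Vec d → ℝ) : Vec d → EReal :=
  fun x => if x ∈ D then (g x : EReal) else ⊤

/-- Convex subdifferential `∂g(x)` of an extended-valued function. -/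
def subdiff {d : ℕ} (g : Vec d → EReal) (x : Vec d) : Set (Vec d) :=
  {v | ∀ y, g x + ((inner ℝ v (y - x) : ℝ) : EReal) ≤ g y}

/-- Subdifferential `{∇f(x)} + ∂χ(x)` of a composite function `f + χ`, with `f` smooth and
`χ` convex. -/
def compSubdiff {d : ℕ} (f : Vec d → ℝ) (χ : Vec d → EReal) (x : Vec d) : Set (Vec d) :=
  {w | ∃ v ∈ subdiff χ x, w = gradient f x + v}

/-- Normal cone of a convex set `D` at `x`. -/
def normalCone {d : ℕ} (D : Set (Vec d)) (x : Vec d) : Set (Vec d) :=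
  {v | ∀ y ∈ D, inner ℝ v (y - x) ≤ 0}

/-- The set `S₀ + ∑ i, l i • S i` (Minkowski sums), a summand with coefficient `l i = 0` being
`{0}`. -/
def weightedSum {d m : ℕ} (S₀ : Set (Vec d)) (l : Vec m) (S : Fin m → Set (Vec d)) :
    Set (Vec d) :=
  {w | ∃ v₀ ∈ S₀, ∃ v : Fin m → Vec d,
    (∀ i, l i ≠ 0 → v i ∈ S i) ∧ w = v₀ + ∑ i, l i • v i}

/-! ### The function constrained problem -/

/-- Data of the problem: minimize `f₀ + χ₀` over `ℝ^d` subject to `f i + χ i ≤ η i`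
for `i : Fin m`; `L₀` and `L i` are the smoothness constants of `f₀` and `f i`.
Only the values of `χ i` on the effective domain of `χ₀` matter. -/
structure Problem (d m : ℕ) where
  f₀ : Vec d → ℝ
  χ₀ : Vec d → EReal
  f : Fin m → Vec d → ℝ
  χ : Fin m → Vec d → ℝ
  η : Fin m → ℝ
  L₀ : ℝ
  L : Fin m → ℝ

namespace Problem

variable {d m : ℕ} (Q : Problem d m)

/-- `dom χ₀`. -/
def dom : Set (Vec d) := effDom Q.χ₀

/-- The constraint function `ψ_i = f_i + χ_i` (on `dom χ₀`). -/
def ψ (i : Fin m) (x : Vec d) : ℝ := Q.f i x + Q.χ i x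

/-- `χ_i` as a convex function with domain `dom χ₀`. If `χ_i` is convex on all of `ℝ^d`, this adds the
normal cone of `dom χ₀` to `∂χ_i`, which changes neither MFCQ (its `z` is nonpositive on normals)
nor the KKT conditions (`∂χ₀` absorbs normals). -/
def χExt (i : Fin m) : Vec d → EReal := extendTop Q.dom (Q.χ i)

/-- The feasible set. -/
def feasible : Set (Vec d) := {x | x ∈ Q.dom ∧ ∀ i, Q.ψ i x ≤ Q.η i}

/-- `f` is differentiable at the points of `D`, with `K`-Lipschitz gradient on `D`. -/
def LipschitzSmoothOn (K : ℝ) (f : Vec d → ℝ) (D : Set (Vec d)) : Prop :=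
  0 ≤ K ∧ (∀ x ∈ D, DifferentiableAt ℝ f x) ∧
    ∀ x ∈ D, ∀ y ∈ D, ‖gradient f x - gradient f y‖ ≤ K * ‖x - y‖

/-- Standing assumptions on the problem. -/
structure Regular : Prop where
  χ₀_proper : IsProperConvexLsc Q.χ₀
  χ_convex : ∀ i, ConvexOn ℝ Q.dom (Q.χ i)
  χ_cont : ∀ i, ContinuousOn (Q.χ i) Q.dom
  f₀_smooth : LipschitzSmoothOn Q.L₀ Q.f₀ Q.dom
  f_smooth : ∀ i, LipschitzSmoothOn (Q.L i) (Q.f i) Q.dom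
  feasible_compact : IsCompact Q.feasible

/-- `∂_x 𝓛(x, l)` for the Lagrangian `𝓛(x, l) = ψ₀(x) + ∑ i, l i * (ψ_i(x) - η_i)`. -/
def lagrangianSubdiff (x : Vec d) (l : Vec m) : Set (Vec d) :=
  weightedSum (compSubdiff Q.f₀ Q.χ₀ x) l (fun i => compSubdiff (Q.f i) (Q.χExt i) x)

/-- KKT points of the problem. -/
def IsKKT (x : Vec d) : Prop :=
  x ∈ Q.feasible ∧ ∃ l : Vec m, (∀ i, 0 ≤ l i) ∧
    0 ∈ Q.lagrangianSubdiff x l ∧ ∑ i, l i * (Q.ψ i x - Q.η i) = 0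

/-- The Mangasarian-Fromovitz constraint qualification at `x`: some `z` in minus the dual cone of
the normal cone of `dom χ₀` satisfies `max {⟪v, z⟫ : v ∈ ∂ψ_i(x)} < 0` for every active `i`. -/
def MFCQ (x : Vec d) : Prop :=
  ∃ z : Vec d, -z ∈ ProperCone.innerDual (normalCone Q.dom x) ∧
    ∀ i, Q.ψ i x = Q.η i →
      ∀ v ∈ compSubdiff (Q.f i) (Q.χExt i) x, (inner ℝ v z : ℝ) < 0

/-- All feasible points satisfy MFCQ. -/
def UniformMFCQ : Prop := ∀ x ∈ Q.feasible, Q.MFCQ x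

/-! ### The subproblem at a point `a`, with gradient estimate `G`, parameter `γ`, levels `e` -/

/-- Smooth part of the surrogate objective. -/
def objModel (G : Vec d) (γ : ℝ) (a y : Vec d) : ℝ :=
  inner ℝ G y + γ / 2 * ‖y - a‖ ^ 2

/-- Smooth part of the surrogate of the `i`-th constraint. -/
def conModel (i : Fin m) (a y : Vec d) : ℝ :=
  Q.f i a + inner ℝ (gradient (Q.f i) a) (y - a) + Q.L i / 2 * ‖y - a‖ ^ 2

/-- Surrogate objective `ψ₀^k`. -/
def surrObj (G : Vec d) (γ : ℝ) (a y : Vec d) : EReal :=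
  ((objModel G γ a y : ℝ) : EReal) + Q.χ₀ y

/-- Surrogate constraint `ψ_i^k`. -/
def surrCon (i : Fin m) (a y : Vec d) : ℝ := Q.conModel i a y + Q.χ i y

/-- Feasible set of the subproblem. -/
def subFeasible (e : Fin m → ℝ) (a : Vec d) : Set (Vec d) :=
  {y | y ∈ Q.dom ∧ ∀ i, Q.surrCon i a y ≤ e i}

/-- `y` is an optimal solution of the subproblem. -/
def IsSubSolution (G : Vec d) (γ : ℝ) (e : Fin m → ℝ) (a y : Vec d) : Prop :=
  y ∈ Q.subFeasible e a ∧
    ∀ w ∈ Q.subFeasible e a, Q.surrObj G γ a y ≤ Q.surrObj G γ a w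

/-- `l` is a vector of Lagrange multipliers of the subproblem at its solution `y`. -/
def IsSubMultiplier (G : Vec d) (γ : ℝ) (e : Fin m → ℝ) (a y : Vec d) (l : Vec m) : Prop :=
  (∀ i, 0 ≤ l i) ∧
  0 ∈ weightedSum (compSubdiff (objModel G γ a) Q.χ₀ y) l
        (fun i => compSubdiff (Q.conModel i a) (Q.χExt i) y) ∧
  ∀ i, l i * (Q.surrCon i a y - e i) = 0

end Problem

/-! ### The stochastic first-order oracle and the algorithm -/

/-- The stochastic gradient `∇F(x, s)` (gradient in `x`). -/
def stochGrad {d : ℕ} {S : Type*} (F : Vec d → S → ℝ) (x : Vec d) (s : S) : Vec d :=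
  gradient (fun y => F y s) x

/-- `f₀(x) = 𝔼 F(x, ξ)` with `ξ ∼ P`, and `∇F(x, ξ)` is an unbiased estimate of `∇f₀(x)` with
variance at most `σ²`, for `x` in the domain `D`. -/
structure IsOracle {d : ℕ} {S : Type*} [MeasurableSpace S] (F : Vec d → S → ℝ) (P : Measure S)
    (f₀ : Vec d → ℝ) (D : Set (Vec d)) (σ : ℝ) : Prop where
  sigma_pos : 0 < σ
  integrable_F : ∀ x ∈ D, Integrable (F x) P
  mean_F : ∀ x ∈ D, f₀ x = ∫ s, F x s ∂P
  differentiable_F : ∀ s, ∀ x ∈ D, DifferentiableAt ℝ (fun y => F y s) x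
  measurable_grad : Measurable (fun p : Vec d × S => stochGrad F p.1 p.2)
  integrable_grad : ∀ x ∈ D, Integrable (stochGrad F x) P
  unbiased : ∀ x ∈ D, ∫ s, stochGrad F x s ∂P = gradient f₀ x
  integrable_sq : ∀ x ∈ D, Integrable (fun s => ‖stochGrad F x s - gradient f₀ x‖ ^ 2) P
  variance_le : ∀ x ∈ D, ∫ s, ‖stochGrad F x s - gradient f₀ x‖ ^ 2 ∂P ≤ σ ^ 2

/-- The `σ`-algebra generated by the minibatches `B_0, …, B_{k-1}`. -/
@[reducible] def pastSigma {Ω S : Type*} [MeasurableSpace S] (b : ℕ → ℕ)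
    (ξ : (k : ℕ) → Fin (b k) → Ω → S) (k : ℕ) : MeasurableSpace Ω :=
  ⨆ j : Fin k, ⨆ i : Fin (b j), MeasurableSpace.comap (ξ j i) inferInstance

/-- Minibatch gradient `G^k = b_k⁻¹ ∑ i, ∇F(x^k, ξ_{i,k})` at the point `x`. -/
def batchGrad {d : ℕ} {Ω S : Type*} (F : Vec d → S → ℝ) (b : ℕ → ℕ)
    (ξ : (k : ℕ) → Fin (b k) → Ω → S) (k : ℕ) (x : Vec d) (ω : Ω) : Vec d :=
  (b k : ℝ)⁻¹ • ∑ i : Fin (b k), stochGrad F x (ξ k i ω)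

/-- The samples in the minibatches (of positive sizes `b k`) are independent with law `P`. -/
structure IsSampling {Ω S : Type*} [MeasurableSpace Ω] [MeasurableSpace S] (μ : Measure Ω)
    (P : Measure S) (b : ℕ → ℕ) (ξ : (k : ℕ) → Fin (b k) → Ω → S) : Prop where
  size_pos : ∀ k, 0 < b k
  measurable : ∀ k i, Measurable (ξ k i)
  law : ∀ k i, Measure.map (ξ k i) μ = P
  indep : iIndepFun (fun q : (Σ k : ℕ, Fin (b k)) => ξ q.1 q.2) μ

/-- Constraint levels: `η^{k+1} = η^k + δ^k < η` with `δ^k > 0`, and `η^k → η`; the starting point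
`x₀` is strictly feasible, `ψ_i(x₀) < η_i^0 < η_i`. -/
structure IsLevelSchedule {d m : ℕ} (Q : Problem d m) (x₀ : Vec d) (e δ : ℕ → Fin m → ℝ) :
    Prop where
  mem_dom : x₀ ∈ Q.dom
  strict : ∀ i, Q.ψ i x₀ < e 0 i ∧ e 0 i < Q.η i
  step_pos : ∀ k i, 0 < δ k i
  update : ∀ k i, e (k + 1) i = e k i + δ k i ∧ e (k + 1) i < Q.η i
  tendsto : ∀ i, Tendsto (fun k => e k i) atTop (𝓝 (Q.η i))

/-- `x` is the sequence of random iterates of LCSPG: `x^0 = x₀`, `x^k` is a function of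
the minibatches `B_0, …, B_{k-1}`, and `x^{k+1}` solves the `k`-th subproblem. -/
structure IsLCSPG {d m : ℕ} {Ω S : Type*} [MeasurableSpace S] (Q : Problem d m)
    (F : Vec d → S → ℝ) (b : ℕ → ℕ) (ξ : (k : ℕ) → Fin (b k) → Ω → S) (γ : ℕ → ℝ)
    (e : ℕ → Fin m → ℝ) (x₀ : Vec d) (x : ℕ → Ω → Vec d) : Prop where
  init : ∀ ω, x 0 ω = x₀
  adapted : ∀ k, Measurable[pastSigma b ξ k] (x k)
  step : ∀ k ω, Q.IsSubSolution (batchGrad F b ξ k (x k ω) ω) (γ k) (e k) (x k ω) (x (k + 1) ω)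

end LevelConstrained

end

noncomputable section

/-! Each quadratic model majorizes its constraint (`descent_of_lipschitz_gradient`), so a solution
of one subproblem satisfies ψ_i ≤ η_i^k < η_i^{k+1} and is a Slater point of the next subproblem.
Hence multipliers exist on every path (`exists_isSubMultiplier`), and all iterates stay in the
compact feasible set.

Testing the optimality condition of a subproblem at its own center gives a decrease of ψ₀
proportional to ‖x^{k+1} - x^k‖², up to a multiple of ‖G^k - ∇f₀(x^k)‖² (`objective_decrease`).
Since x^k is independent of the k-th batch, the mean of this error is at most σ²/b_k, so the errors
are almost surely summable (`ae_summable_error`). As ψ₀ is bounded below on the feasible set, the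
steps tend to 0. From there on the argument is deterministic along a path.

Optimality of a subproblem is written as one variational inequality over dom χ₀, free of individual
subgradients. It survives limits even after scaling the multipliers (`limit_optimality`). If
multipliers were unbounded, dividing by their norms would remove the objective and leave a unit
multiplier of the constraints alone, which MFCQ forbids (`eq_zero_of_mfcq`). With bounded
multipliers the unscaled limit is the KKT condition, once the inequality is split back into
subgradients by the sum rule `exists_subgradients_of_sum`. -/

namespace LevelConstrained

/-! ### Convex analysis: sandwich theorem, sum rule, Slater multipliers, descent lemma. -/

section ConvexAnalysis

/-- Sandwich theorem on a convex set with nonempty interior, for functions touching at `0`. -/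
theorem exists_clm_between {V : Type*} [NormedAddCommGroup V] [NormedSpace ℝ V]
    [FiniteDimensional ℝ V] {D : Set V} (hD : (interior D).Nonempty) (h0 : (0 : V) ∈ D)
    {a b : V → ℝ} (ha : ConvexOn ℝ D a) (hb : ConcaveOn ℝ D b) (hle : ∀ w ∈ D, b w ≤ a w)
    (ha0 : a 0 = 0) (hb0 : b 0 = 0) :
    ∃ f : V →L[ℝ] ℝ, ∀ w ∈ D, b w ≤ f w ∧ f w ≤ a w := by
  -- `a` may jump at the boundary of `D`. Over the interior it is continuous, so its strict epigraph
  -- there is open and can be separated from the hypograph of `b`.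
  have haI : ConvexOn ℝ (interior D) a := ha.subset interior_subset ha.1.interior
  have hopen : IsOpen {p : V × ℝ | p.1 ∈ interior D ∧ a p.1 < p.2} := by
    have hc : ContinuousOn (fun p : V × ℝ => p.2 - a p.1) (interior D ×ˢ Set.univ) :=
      continuousOn_snd.sub (ha.continuousOn_interior.comp continuousOn_fst fun p hp => hp.1)
    have := hc.isOpen_inter_preimage (isOpen_interior.prod isOpen_univ) (isOpen_Ioi (a := 0))
    convert! this using 1
    ext p
    simp
  have hdisj : Disjoint {p : V × ℝ | p.1 ∈ interior D ∧ a p.1 < p.2}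
      {p : V × ℝ | p.1 ∈ D ∧ p.2 ≤ b p.1} := by
    rw [Set.disjoint_left]
    rintro p ⟨_, h1⟩ ⟨h2, h3⟩
    linarith [hle _ h2]
  obtain ⟨f, u, hs, ht⟩ := geometric_hahn_banach_open haI.convex_strict_epigraph hopen
    hb.convex_hypograph hdisj
  set c := f (0, 1) with hc
  have hf : ∀ w t, f (w, t) = f (w, 0) + t * c := by
    intro w t
    have : (w, t) = (w, (0 : ℝ)) + t • ((0 : V), (1 : ℝ)) := by simp
    rw [this, map_add, map_smul, smul_eq_mul]
  have hu0 : u ≤ 0 := by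
    have := ht (0, 0) ⟨h0, by simp [hb0]⟩
    rwa [show ((0 : V), (0 : ℝ)) = 0 from rfl, map_zero] at this
  obtain ⟨z, hz⟩ := hD
  -- The separating hyperplane is not vertical, because both sets have points above the same
  -- interior point `z`.
  have hcneg : c < 0 := by
    have h1 := hs (z, a z + 1) ⟨hz, by simp⟩
    have h2 := ht (z, b z) ⟨interior_subset hz, le_rfl⟩
    rw [hf] at h1 h2
    nlinarith [hle z (interior_subset hz)]
  have hint : ∀ w ∈ interior D, f (w, 0) + a w * c ≤ u := by
    intro w hw
    refine le_of_forall_pos_lt_add fun ε hε => ?_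
    have h1 := hs (w, a w + ε / (-c)) ⟨hw, by
      have : 0 < ε / (-c) := div_pos hε (by linarith)
      simpa using this⟩
    rw [hf, add_mul] at h1
    have : ε / (-c) * c = -ε := by rw [div_neg, neg_mul, div_mul_cancel₀ _ hcneg.ne]
    linarith
  -- A boundary point is reached along the segment from `z`. Convexity bounds `a` there by its
  -- chord, and `c < 0` gives the right direction.
  have hall : ∀ w ∈ D, f (w, 0) + a w * c ≤ u := by
    intro w hw
    have hlim : Tendsto (fun t : ℝ => t * (f (z, 0) + a z * c) + (1 - t) * (f (w, 0) + a w * c))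
        (𝓝[>] 0) (𝓝 (0 * (f (z, 0) + a z * c) + (1 - 0) * (f (w, 0) + a w * c))) := by
      apply Tendsto.mono_left _ nhdsWithin_le_nhds
      apply Continuous.tendsto
      fun_prop
    rw [zero_mul, zero_add, sub_zero, one_mul] at hlim
    refine le_of_tendsto hlim ?_
    filter_upwards [Ioo_mem_nhdsGT (zero_lt_one (α := ℝ))] with t ht
    have hp := ha.1.combo_interior_self_mem_interior hz hw ht.1 (sub_nonneg.2 ht.2.le)
      (add_sub_cancel t 1)
    have h1 := hint _ hp
    have h2 := ha.2 (interior_subset hz) hw ht.1.le (sub_nonneg.2 ht.2.le) (add_sub_cancel t 1)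
    have h3 : f (t • z + (1 - t) • w, 0) = t * f (z, 0) + (1 - t) * f (w, 0) := by
      have : (t • z + (1 - t) • w, (0 : ℝ)) = t • (z, (0 : ℝ)) + (1 - t) • (w, (0 : ℝ)) := by simp
      rw [this, map_add, map_smul, map_smul, smul_eq_mul, smul_eq_mul]
    rw [h3] at h1
    simp only [smul_eq_mul] at h2
    nlinarith
  have hu : u = 0 := by
    refine le_antisymm hu0 ?_
    have := hall 0 h0
    rwa [show ((0 : V), (0 : ℝ)) = 0 from rfl, map_zero, ha0, zero_mul, add_zero] at this
  refine ⟨(-c)⁻¹ • f.comp (ContinuousLinearMap.inl ℝ V ℝ), fun w hw => ?_⟩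
  have h1 := hall w hw
  have h2 := ht (w, b w) ⟨hw, le_rfl⟩
  rw [hf] at h2
  have hpos : 0 < -c := by linarith
  simp only [smul_apply, ContinuousLinearMap.comp_apply,
    ContinuousLinearMap.inl_apply, smul_eq_mul]
  rw [inv_mul_eq_div, le_div_iff₀ hpos, div_le_iff₀ hpos]
  constructor <;> linarith

variable {E : Type*} [NormedAddCommGroup E] [InnerProductSpace ℝ E]

/-- Sandwich theorem on an arbitrary convex set of a finite-dimensional space. -/
theorem exists_inner_between [FiniteDimensional ℝ E] {D : Set E} {y : E} (hy : y ∈ D)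
    {a b : E → ℝ} (ha : ConvexOn ℝ D a) (hb : ConcaveOn ℝ D b) (hle : ∀ w ∈ D, b w ≤ a w)
    (hay : a y = 0) (hby : b y = 0) :
    ∃ v : E, ∀ w ∈ D, b w ≤ inner ℝ v (w - y) ∧ inner ℝ v (w - y) ≤ a w := by
  -- `D` may have empty interior in `E`, but `D - y` has nonempty interior in its own span `V`. The
  -- functional found on `V` is then represented by a vector of `V`.
  set V : Submodule ℝ E := Submodule.span ℝ ((fun w => w - y) '' D) with hV
  set T : V →ᵃ[ℝ] E := V.subtype.toAffineMap + AffineMap.const ℝ V y with hT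
  have hTa : ∀ u : V, T u = u + y := fun u => by simp [hT]
  have h0 : (0 : V) ∈ T ⁻¹' D := by simp [hTa, hy]
  have hpre : T ⁻¹' D = (Subtype.val : V → E) ⁻¹' ((fun w => w - y) '' D) := by
    ext u
    simp only [Set.mem_preimage, hTa, Set.mem_image]
    exact ⟨fun h => ⟨_, h, by simp⟩, by rintro ⟨w, hw, h⟩; rw [← h]; simpa using hw⟩
  have hspan : Submodule.span ℝ (T ⁻¹' D) = ⊤ := by
    rw [hpre]
    exact Submodule.span_span_coe_preimage
  have hconv : Convex ℝ (T ⁻¹' D) := ha.1.affine_preimage T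
  have hint : (interior (T ⁻¹' D)).Nonempty := by
    rw [hconv.interior_nonempty_iff_affineSpan_eq_top,
      AffineSubspace.affineSpan_eq_top_iff_vectorSpan_eq_top_of_nonempty ℝ V V ⟨0, h0⟩,
      vectorSpan_eq_span_vsub_set_right ℝ h0]
    simpa using hspan
  obtain ⟨f, hf⟩ := exists_clm_between hint h0 (ha.comp_affineMap T) (hb.comp_affineMap T)
    (fun w hw => hle _ hw) (by simp [hTa, hay]) (by simp [hTa, hby])
  refine ⟨((InnerProductSpace.toDual ℝ V).symm f : V), fun w hw => ?_⟩
  have hwV : w - y ∈ V := Submodule.subset_span ⟨w, hw, rfl⟩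
  have h1 : inner ℝ (((InnerProductSpace.toDual ℝ V).symm f : V) : E) (w - y) = f ⟨w - y, hwV⟩ := by
    rw [← InnerProductSpace.toDual_symm_apply (𝕜 := ℝ) (E := V)]
    rfl
  have h2 := hf ⟨w - y, hwV⟩ (by simpa [hTa] using hw)
  simp only [Function.comp, hTa, sub_add_cancel] at h2
  rwa [h1]

theorem convexOn_sum_mul {D : Set E} (hD : Convex ℝ D) {ι : Type*} (s : Finset ι)
    {g : ι → E → ℝ} {l : ι → ℝ} (hg : ∀ i ∈ s, ConvexOn ℝ D (g i)) (hl : ∀ i ∈ s, 0 ≤ l i) :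
    ConvexOn ℝ D (fun w => ∑ i ∈ s, l i * g i w) := by
  classical
  induction s using Finset.induction_on with
  | empty => simpa using convexOn_const 0 hD
  | insert k t hk iht =>
    simp only [Finset.sum_insert hk]
    exact ((hg k (Finset.mem_insert_self k t)).smul (hl k (Finset.mem_insert_self k t))).add
      (iht (fun i hi => hg i (Finset.mem_insert_of_mem hi))
        fun i hi => hl i (Finset.mem_insert_of_mem hi))

/-- Sum rule for the subdifferential of a positive combination of convex functions with a
common domain. -/
theorem exists_subgradients_of_sum [FiniteDimensional ℝ E] {D : Set E} {y : E} (hy : y ∈ D)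
    {ι : Type*} (s : Finset ι) {g₀ : E → ℝ} {g : ι → E → ℝ} {l : ι → ℝ} (hg₀ : ConvexOn ℝ D g₀)
    (hg : ∀ i ∈ s, ConvexOn ℝ D (g i)) (hl : ∀ i ∈ s, 0 < l i) {v : E}
    (h : ∀ w ∈ D, g₀ y + ∑ i ∈ s, l i * g i y + inner ℝ v (w - y) ≤ g₀ w + ∑ i ∈ s, l i * g i w) :
    ∃ (u₀ : E) (u : ι → E), u₀ + ∑ i ∈ s, l i • u i = v ∧
      (∀ w ∈ D, g₀ y + inner ℝ u₀ (w - y) ≤ g₀ w) ∧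
      ∀ i ∈ s, ∀ w ∈ D, g i y + inner ℝ (u i) (w - y) ≤ g i w := by
  classical
  induction s using Finset.induction_on generalizing v with
  | empty => exact ⟨v, 0, by simp, by simpa using h, by simp⟩
  | insert j s hj ih =>
    have hlj : 0 < l j := hl j (Finset.mem_insert_self j s)
    have hsum : ConvexOn ℝ D (fun w => g₀ w + ∑ i ∈ s, l i * g i w) := by
      refine hg₀.add ?_
      exact convexOn_sum_mul hg₀.1 s (fun i hi => hg i (Finset.mem_insert_of_mem hi))
        fun i hi => (hl i (Finset.mem_insert_of_mem hi)).le
    have hlin : ConvexOn ℝ D (fun w => g₀ y + ∑ i ∈ s, l i * g i y + inner ℝ v (w - y)) := by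
      refine ⟨hg₀.1, fun p _ q _ α β _ _ hαβ => le_of_eq ?_⟩
      simp only [smul_eq_mul, inner_sub_right, inner_add_right, inner_smul_right]
      linear_combination (g₀ y + ∑ i ∈ s, l i * g i y - inner ℝ v y) * -hαβ
    have hlin' : ConcaveOn ℝ D (fun w => g₀ y + ∑ i ∈ s, l i * g i y + inner ℝ v (w - y)) := by
      refine ⟨hg₀.1, fun p _ q _ α β _ _ hαβ => le_of_eq ?_⟩
      simp only [smul_eq_mul, inner_sub_right, inner_add_right, inner_smul_right]
      linear_combination -(g₀ y + ∑ i ∈ s, l i * g i y - inner ℝ v y) * -hαβ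
    -- The hypothesis places the concave function `-(l j) (g j - g j y)` below the convex gap left
    -- by the remaining terms. A linear function `p` in between makes `v + p` a subgradient of the
    -- remaining sum and `-p / l j` one of `g j`. No further qualification is needed since all
    -- functions are finite on the same `D`.
    obtain ⟨p, hp⟩ := exists_inner_between hy
      (a := fun w => g₀ w + ∑ i ∈ s, l i * g i w -
        (g₀ y + ∑ i ∈ s, l i * g i y + inner ℝ v (w - y)))
      (b := fun w => -(l j * g j w - l j * g j y))
      (hsum.sub hlin')
      ((((hg j (Finset.mem_insert_self j s)).smul hlj.le).sub (concaveOn_const _ hg₀.1)).neg)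
      (fun w hw => by
        have := h w hw
        simp only [Finset.sum_insert hj] at this
        linarith) (by simp) (by simp)
    obtain ⟨u₀, u, hu, hu₀, hui⟩ := ih (v := v + p)
      (fun i hi => hg i (Finset.mem_insert_of_mem hi))
      (fun i hi => hl i (Finset.mem_insert_of_mem hi))
      (fun w hw => by
        have := (hp w hw).2
        rw [inner_add_left]
        linarith)
    refine ⟨u₀, Function.update u j (-(l j)⁻¹ • p), ?_, hu₀, ?_⟩
    · rw [Finset.sum_insert hj, Function.update_self]
      have : ∑ i ∈ s, l i • Function.update u j (-(l j)⁻¹ • p) i = ∑ i ∈ s, l i • u i :=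
        Finset.sum_congr rfl fun i hi => by
          rw [Function.update_of_ne (ne_of_mem_of_not_mem hi hj)]
      rw [this, smul_smul, mul_neg, mul_inv_cancel₀ hlj.ne', add_left_comm, hu]
      simp
    · intro i hi w hw
      rcases Finset.mem_insert.1 hi with rfl | hi
      · rw [Function.update_self, inner_smul_left]
        have h1 := (hp w hw).1
        simp only [map_neg, conj_trivial]
        have h2 : (l i)⁻¹ * (-(l i * g i w - l i * g i y)) ≤ (l i)⁻¹ * inner ℝ p (w - y) :=
          mul_le_mul_of_nonneg_left h1 (inv_pos.2 hlj).le
        have h3 : (l i)⁻¹ * (-(l i * g i w - l i * g i y)) = g i y - g i w := by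
          field_simp
          ring
        linarith
      · rw [Function.update_of_ne (ne_of_mem_of_not_mem hi hj)]
        exact hui i hi w hw

/-- Lagrange multipliers for a convex program satisfying Slater's condition. -/
theorem exists_multipliers_of_slater {X : Type*} [AddCommGroup X] [Module ℝ X] {D : Set X}
    {ι : Type*} [Fintype ι] {g₀ : X → ℝ} {g : ι → X → ℝ} (hg₀ : ConvexOn ℝ D g₀)
    (hg : ∀ i, ConvexOn ℝ D (g i)) {a y : X} (ha : a ∈ D) (hga : ∀ i, g i a < 0)
    (hmin : ∀ w ∈ D, (∀ i, g i w ≤ 0) → g₀ y ≤ g₀ w) :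
    ∃ l : ι → ℝ, (∀ i, 0 ≤ l i) ∧ ∀ w ∈ D, g₀ y ≤ g₀ w + ∑ i, l i * g i w := by
  classical
  -- Strict inequalities make `A` open, and optimality of `y` keeps the origin out of it. The
  -- multipliers are the coefficients of a functional positive on `A`, normalized by the objective
  -- coefficient `c`.
  set A : Set ((ι → ℝ) × ℝ) :=
    {p | ∃ w ∈ D, (∀ i, g i w < p.1 i) ∧ g₀ w - g₀ y < p.2} with hA
  have hAc : Convex ℝ A := by
    rintro p ⟨w, hw, hw1, hw2⟩ q ⟨w', hw', hw1', hw2'⟩ α β hα hβ hαβ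
    have key : ∀ r s r' s' : ℝ, r < r' → s < s' → α * r + β * s < α * r' + β * s' := by
      intro r s r' s' h1 h2
      rcases hα.eq_or_lt with rfl | hα'
      · have : β = 1 := by linarith
        subst this
        linarith
      · nlinarith
    refine ⟨α • w + β • w', hg₀.1 hw hw' hα hβ hαβ, fun i => ?_, ?_⟩
    · refine ((hg i).2 hw hw' hα hβ hαβ).trans_lt ?_
      exact key _ _ _ _ (hw1 i) (hw1' i)
    · have h1 := hg₀.2 hw hw' hα hβ hαβ
      have h2 := key _ _ _ _ hw2 hw2'
      simp only [smul_eq_mul] at h1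
      show g₀ (α • w + β • w') - g₀ y < α * p.2 + β * q.2
      have h3 : α * (g₀ w - g₀ y) + β * (g₀ w' - g₀ y) = α * g₀ w + β * g₀ w' - g₀ y := by
        linear_combination -g₀ y * hαβ
      linarith
  have hAo : IsOpen A := by
    have : A = ⋃ w ∈ D, ((⋂ i, {p : (ι → ℝ) × ℝ | g i w < p.1 i}) ∩ {p | g₀ w - g₀ y < p.2}) := by
      ext p
      simp [hA, and_left_comm]
    rw [this]
    refine isOpen_biUnion fun w _ => (isOpen_iInter_of_finite fun i => ?_).inter ?_
    · exact isOpen_lt continuous_const ((continuous_apply i).comp continuous_fst)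
    · exact isOpen_lt continuous_const continuous_snd
  have h0 : (0 : (ι → ℝ) × ℝ) ∉ A := by
    rintro ⟨w, hw, h1, h2⟩
    have := hmin w hw fun i => (h1 i).le
    simp only [Prod.snd_zero] at h2
    linarith
  obtain ⟨f, hf⟩ := geometric_hahn_banach_point_open hAc hAo h0
  rw [map_zero] at hf
  set q : ι → ℝ := fun i => f (Pi.single i 1, 0) with hq
  set c : ℝ := f (0, 1) with hc
  have hfe : ∀ u t, f (u, t) = ∑ i, u i * q i + t * c := by
    intro u t
    have : (u, t) = ∑ i, u i • ((Pi.single i 1 : ι → ℝ), (0 : ℝ)) + t • ((0 : ι → ℝ), (1 : ℝ)) := by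
      ext j
      · simp [Prod.fst_sum, Finset.sum_apply, Pi.single_apply]
      · simp [Prod.snd_sum]
    rw [this, map_add, map_sum, map_smul, smul_eq_mul]
    simp only [map_smul, smul_eq_mul, hq, hc]
  have haff : ∀ r s : ℝ, (∀ t : ℝ, 0 ≤ t → 0 < r + t * s) → 0 ≤ s := by
    intro r s h
    by_contra! hs
    have hr : 0 < r := by simpa using h 0 le_rfl
    have h1 := h (r / -s) (div_nonneg hr.le (by linarith))
    have : r / -s * s = -r := by rw [div_neg, neg_mul, div_mul_cancel₀ _ hs.ne]
    linarith
  -- The Slater point puts into `A` a point with zero constraint part. Positivity of `f` there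
  -- forces `c ≠ 0`.
  set p₀ : (ι → ℝ) × ℝ := (0, g₀ a - g₀ y + 1) with hp₀
  have hp : p₀ ∈ A := ⟨a, ha, hga, by simp [hp₀]⟩
  have hmono : ∀ d : (ι → ℝ) × ℝ, (∀ i, 0 ≤ d.1 i) → 0 ≤ d.2 → 0 ≤ f d := by
    intro d h1 h2
    refine haff (f p₀) (f d) fun t ht => ?_
    have hm : p₀ + t • d ∈ A := by
      obtain ⟨w, hw, hw1, hw2⟩ := hp
      refine ⟨w, hw, fun i => ?_, ?_⟩
      · have := mul_nonneg ht (h1 i)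
        simp only [Prod.fst_add, Prod.smul_fst, Pi.add_apply, Pi.smul_apply, smul_eq_mul]
        linarith [hw1 i]
      · have := mul_nonneg ht h2
        simp only [Prod.snd_add, Prod.smul_snd, smul_eq_mul]
        linarith
    simpa using hf _ hm
  have hq0 : ∀ i, 0 ≤ q i := fun i => hmono _ (fun j => by
    simp only [Pi.single_apply]; split_ifs <;> norm_num) le_rfl
  have hc0 : 0 ≤ c := hmono _ (fun j => le_rfl) (by norm_num)
  have hcpos : 0 < c := by
    have h1 := hf _ hp
    rw [hfe] at h1
    simp only [Pi.zero_apply, zero_mul, Finset.sum_const_zero, zero_add] at h1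
    exact hc0.lt_of_ne' fun h => by simp [h] at h1
  have hmain : ∀ w ∈ D, 0 ≤ ∑ i, g i w * q i + (g₀ w - g₀ y) * c := by
    intro w hw
    have hK : 0 < ∑ i, q i + c := by
      have := Finset.sum_nonneg fun i (_ : i ∈ Finset.univ) => hq0 i
      linarith
    refine le_of_forall_pos_lt_add fun ε hε => ?_
    have hη : 0 < ε / (∑ i, q i + c) := div_pos hε hK
    have h1 := hf ((fun i => g i w + ε / (∑ i, q i + c)), g₀ w - g₀ y + ε / (∑ i, q i + c))
      ⟨w, hw, fun i => by simpa using hη, by simpa using hη⟩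
    rw [hfe] at h1
    simp only [add_mul, Finset.sum_add_distrib, ← Finset.mul_sum] at h1
    have h2 : ε / (∑ i, q i + c) * ∑ i, q i + ε / (∑ i, q i + c) * c = ε := by
      rw [← mul_add]
      field_simp
    linarith
  refine ⟨fun i => q i / c, fun i => div_nonneg (hq0 i) hc0, fun w hw => ?_⟩
  have h1 := hmain w hw
  have h2 : ∑ i, q i / c * g i w = (∑ i, g i w * q i) / c := by
    rw [Finset.sum_div]
    exact Finset.sum_congr rfl fun i _ => by ring
  have h3 : g₀ y - g₀ w ≤ (∑ i, g i w * q i) / c := by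
    rw [le_div_iff₀ hcpos]
    linarith
  show g₀ y ≤ g₀ w + ∑ i, q i / c * g i w
  rw [h2]
  linarith

variable [CompleteSpace E]

/-- First-order condition at a minimizer of a sum of a smooth and a convex function. -/
theorem linearized_min_of_min {D : Set E} {h q : E → ℝ} {p y : E} (hh : ConvexOn ℝ D h)
    (hy : y ∈ D) (hq : HasGradientAt q p y) (hmin : ∀ w ∈ D, q y + h y ≤ q w + h w) :
    ∀ w ∈ D, h y ≤ h w + inner ℝ p (w - y) := by
  intro w hw
  -- On the segment the nonsmooth `h` is replaced by its chord, which lies above it and agrees at `t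
  -- = 0`. The comparison function is differentiable at 0 and still minimal there.
  have hd : HasDerivAt (fun t : ℝ => q (y + t • (w - y)) + t * (h w - h y))
      (inner ℝ p (w - y) + (h w - h y)) 0 := by
    have h1 : HasDerivAt (fun t : ℝ => y + t • (w - y)) (w - y) 0 := by
      simpa using ((hasDerivAt_id (0 : ℝ)).smul_const (w - y)).const_add y
    have h2 : HasFDerivAt q (InnerProductSpace.toDual ℝ E p) (y + (0 : ℝ) • (w - y)) := by
      simpa using hq.hasFDerivAt
    have h3 := h2.comp_hasDerivAt (0 : ℝ) h1
    have h4 := (hasDerivAt_id (0 : ℝ)).mul_const (h w - h y)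
    rw [one_mul] at h4
    have h5 := h3.add h4
    rw [InnerProductSpace.toDual_apply_apply] at h5
    exact h5
  have hm : IsLocalMinOn (fun t : ℝ => q (y + t • (w - y)) + t * (h w - h y)) (Set.Icc 0 1) 0 := by
    apply IsMinOn.localize
    intro t ht
    have e : (1 - t) • y + t • w = y + t • (w - y) := by module
    have hp := hh.1 hy hw (sub_nonneg.2 ht.2) ht.1 (sub_add_cancel 1 t)
    have h2 := hh.2 hy hw (sub_nonneg.2 ht.2) ht.1 (sub_add_cancel 1 t)
    rw [e] at hp h2
    have h1 := hmin _ hp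
    simp only [smul_eq_mul] at h2
    simp only [Set.mem_ofPred_eq, zero_smul, add_zero, zero_mul]
    linarith
  have := hm.hasFDerivWithinAt_nonneg hd.hasFDerivAt.hasFDerivWithinAt (y := 1)
    (mem_posTangentConeAt_of_segment_subset (by
      rw [zero_add, segment_eq_Icc zero_le_one]))
  simp at this
  linarith

/-- Descent lemma. -/
theorem descent_of_lipschitz_gradient {D : Set E} (hD : Convex ℝ D) {f : E → ℝ} {K : ℝ}
    (hf : ∀ x ∈ D, DifferentiableAt ℝ f x)
    (hK : ∀ x ∈ D, ∀ y ∈ D, ‖gradient f x - gradient f y‖ ≤ K * ‖x - y‖) {x y : E}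
    (hx : x ∈ D) (hy : y ∈ D) :
    f y ≤ f x + inner ℝ (gradient f x) (y - x) + K / 2 * ‖y - x‖ ^ 2 := by
  -- `φ` is `f` on the segment minus the linear and quadratic terms of the bound. The Lipschitz
  -- estimate makes it nonincreasing, and the claim is `φ 1 ≤ φ 0`.
  set φ : ℝ → ℝ := fun t => f (x + t • (y - x)) -
    (t * inner ℝ (gradient f x) (y - x) + t ^ 2 * (K / 2 * ‖y - x‖ ^ 2)) with hφ
  have hmem : ∀ t ∈ Set.Icc (0 : ℝ) 1, x + t • (y - x) ∈ D := fun t ht =>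
    hD.add_smul_sub_mem hx hy ht
  have hder : ∀ t ∈ Set.Icc (0 : ℝ) 1, HasDerivAt φ
      (inner ℝ (gradient f (x + t • (y - x))) (y - x) -
        (inner ℝ (gradient f x) (y - x) + 2 * t * (K / 2 * ‖y - x‖ ^ 2))) t := by
    intro t ht
    have h1 : HasDerivAt (fun t : ℝ => x + t • (y - x)) (y - x) t := by
      simpa using ((hasDerivAt_id t).smul_const (y - x)).const_add x
    have h3 := (hf _ (hmem t ht)).hasGradientAt.hasFDerivAt.comp_hasDerivAt t h1
    have h4 := (hasDerivAt_id t).mul_const (inner ℝ (gradient f x) (y - x))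
    have h5 := (hasDerivAt_pow 2 t).mul_const (K / 2 * ‖y - x‖ ^ 2)
    have h6 := h3.sub (h4.add h5)
    rw [InnerProductSpace.toDual_apply_apply, one_mul] at h6
    refine h6.congr_deriv ?_
    simp
  have hanti : AntitoneOn φ (Set.Icc 0 1) := by
    refine antitoneOn_of_deriv_nonpos (convex_Icc 0 1)
      (fun t ht => (hder t ht).continuousAt.continuousWithinAt)
      (fun t ht => (hder t (interior_subset ht)).differentiableAt.differentiableWithinAt) ?_
    intro t ht
    have ht' := interior_subset ht
    rw [(hder t ht').deriv]
    have h1 := hK _ (hmem t ht') _ hx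
    have h2 := real_inner_le_norm (gradient f (x + t • (y - x)) - gradient f x) (y - x)
    rw [inner_sub_left] at h2
    rw [add_sub_cancel_left, norm_smul, Real.norm_of_nonneg ht'.1] at h1
    nlinarith [norm_nonneg (y - x)]
  have := hanti (Set.left_mem_Icc.2 zero_le_one) (Set.right_mem_Icc.2 zero_le_one) zero_le_one
  simp only [hφ, one_smul, zero_smul, add_zero, add_sub_cancel] at this
  linarith

end ConvexAnalysis

/-! ### Reduction to real inequalities on the domain, and the quadratic models. -/

/-- Subgradients at a point of the domain `D` of an extended-valued function that is finite
exactly on `D`. -/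
theorem mem_subdiff_iff {d : ℕ} {g : Vec d → EReal} {D : Set (Vec d)} {r : Vec d → ℝ}
    (hg : ∀ w ∈ D, g w = (r w : EReal)) (hout : ∀ w ∉ D, g w = ⊤) {x v : Vec d} (hx : x ∈ D) :
    v ∈ subdiff g x ↔ ∀ w ∈ D, r x + inner ℝ v (w - x) ≤ r w := by
  constructor
  · intro h w hw
    have := h w
    rw [hg x hx, hg w hw] at this
    exact_mod_cast this
  · intro h w
    by_cases hw : w ∈ D
    · rw [hg x hx, hg w hw]
      exact_mod_cast h w hw
    · rw [hout w hw]
      exact le_top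

namespace Problem

variable {d m : ℕ} {Q : Problem d m}

/-- The finite values of `χ₀`. -/
def χ₀Real (Q : Problem d m) (x : Vec d) : ℝ := (Q.χ₀ x).toReal

/-- The objective `ψ₀ = f₀ + χ₀` on `dom χ₀`. -/
def ψ₀ (Q : Problem d m) (x : Vec d) : ℝ := Q.f₀ x + Q.χ₀Real x

theorem Regular.coe_χ₀Real (hQ : Q.Regular) {x : Vec d} (hx : x ∈ Q.dom) :
    Q.χ₀ x = (Q.χ₀Real x : EReal) :=
  (EReal.coe_toReal hx (hQ.χ₀_proper.ne_bot x)).symm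

theorem Regular.convexOn_χ₀Real (hQ : Q.Regular) : ConvexOn ℝ Q.dom Q.χ₀Real := by
  rw [convexOn_iff_convex_epigraph]
  convert! hQ.χ₀_proper.convex_epigraph using 1
  ext p
  simp only [Set.mem_ofPred_eq]
  constructor
  · rintro ⟨h1, h2⟩
    rw [hQ.coe_χ₀Real h1]
    exact_mod_cast h2
  · intro h
    have h1 : p.1 ∈ Q.dom := fun h0 => by simp [h0] at h
    rw [hQ.coe_χ₀Real h1] at h
    exact ⟨h1, by exact_mod_cast h⟩

theorem Regular.convex_dom (hQ : Q.Regular) : Convex ℝ Q.dom := hQ.convexOn_χ₀Real.1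

theorem Regular.mem_subdiff_χ₀ (hQ : Q.Regular) {x v : Vec d} (hx : x ∈ Q.dom) :
    v ∈ subdiff Q.χ₀ x ↔ ∀ w ∈ Q.dom, Q.χ₀Real x + inner ℝ v (w - x) ≤ Q.χ₀Real w :=
  mem_subdiff_iff (fun _ hw => hQ.coe_χ₀Real hw)
    (fun w hw => by by_contra h; exact hw h) hx

theorem mem_subdiff_χExt {i : Fin m} {x v : Vec d} (hx : x ∈ Q.dom) :
    v ∈ subdiff (Q.χExt i) x ↔ ∀ w ∈ Q.dom, Q.χ i x + inner ℝ v (w - x) ≤ Q.χ i w :=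
  mem_subdiff_iff (fun _ hw => if_pos hw) (fun _ hw => if_neg hw) hx

theorem LipschitzSmoothOn.continuousOn_gradient {K : ℝ} {f : Vec d → ℝ} {D : Set (Vec d)}
    (hf : LipschitzSmoothOn K f D) : ContinuousOn (gradient f) D := by
  have : LipschitzOnWith K.toNNReal (gradient f) D :=
    LipschitzOnWith.of_dist_le_mul fun x hx y hy => by
      rw [dist_eq_norm, dist_eq_norm, Real.coe_toNNReal _ hf.1]
      exact hf.2.2 x hx y hy
  exact this.continuousOn

theorem LipschitzSmoothOn.continuousOn {K : ℝ} {f : Vec d → ℝ} {D : Set (Vec d)}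
    (hf : LipschitzSmoothOn K f D) : ContinuousOn f D :=
  fun x hx => (hf.2.1 x hx).continuousAt.continuousWithinAt

/-- The objective and constraint models share this shape, so gradients and convexity are computed
once for both. -/
theorem hasGradientAt_quadratic (c : ℝ) (v a y : Vec d) (C : ℝ) :
    HasGradientAt (fun w => inner ℝ v w + C + c / 2 * ‖w - a‖ ^ 2) (v + c • (y - a)) y := by
  rw [hasGradientAt_iff_hasFDerivAt]
  have h1 : HasFDerivAt (fun w : Vec d => inner ℝ v w) (innerSL ℝ v) y :=
    (innerSL ℝ v).hasFDerivAt
  have h2 : HasFDerivAt (fun w : Vec d => ‖w - a‖ ^ 2) (2 • (innerSL ℝ (y - a))) y := by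
    simpa using ((hasFDerivAt_id (𝕜 := ℝ) y).sub_const a).norm_sq
  refine ((h1.add_const C).add (h2.const_mul (c / 2))).congr_fderiv ?_
  ext w
  simp
  ring

theorem convexOn_quadratic {c : ℝ} (hc : 0 ≤ c) (v a : Vec d) (C : ℝ) {D : Set (Vec d)}
    (hD : Convex ℝ D) : ConvexOn ℝ D (fun w => inner ℝ v w + C + c / 2 * ‖w - a‖ ^ 2) := by
  have h1 : ConvexOn ℝ D (fun w => inner ℝ v w) := (innerSL ℝ v).toLinearMap.convexOn hD
  have h2 : ConvexOn ℝ D (fun w => ‖w - a‖ ^ 2) := by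
    have h3 : ConvexOn ℝ Set.univ (fun w : Vec d => ‖w‖ ^ 2) :=
      convexOn_univ_norm.pow (fun _ _ => norm_nonneg _) 2
    have h4 := h3.translate_left (-a)
    refine ConvexOn.subset ?_ (Set.subset_univ D) hD
    simpa [Function.comp_def, sub_eq_add_neg] using h4
  exact (h1.add_const C).add (h2.smul (by positivity))

theorem objModel_eq (G : Vec d) (γ : ℝ) (a : Vec d) :
    objModel G γ a = fun w => inner ℝ G w + 0 + γ / 2 * ‖w - a‖ ^ 2 := by
  ext w
  simp [objModel]

theorem conModel_eq (Q : Problem d m) (i : Fin m) (a : Vec d) :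
    Q.conModel i a = fun w => inner ℝ (gradient (Q.f i) a) w +
      (Q.f i a - inner ℝ (gradient (Q.f i) a) a) + Q.L i / 2 * ‖w - a‖ ^ 2 := by
  ext w
  rw [conModel, inner_sub_right]
  ring

theorem hasGradientAt_objModel (G : Vec d) (γ : ℝ) (a y : Vec d) :
    HasGradientAt (objModel G γ a) (G + γ • (y - a)) y := by
  rw [objModel_eq]
  exact hasGradientAt_quadratic γ G a y 0

theorem hasGradientAt_conModel (Q : Problem d m) (i : Fin m) (a y : Vec d) :
    HasGradientAt (Q.conModel i a) (gradient (Q.f i) a + Q.L i • (y - a)) y := by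
  rw [conModel_eq]
  exact hasGradientAt_quadratic _ _ a y _

theorem Regular.convexOn_surrCon (hQ : Q.Regular) (i : Fin m) (a : Vec d) :
    ConvexOn ℝ Q.dom (Q.surrCon i a) := by
  have h := convexOn_quadratic (hQ.f_smooth i).1 (gradient (Q.f i) a) a
    (Q.f i a - inner ℝ (gradient (Q.f i) a) a) hQ.convex_dom
  rw [← conModel_eq] at h
  exact h.add (hQ.χ_convex i)

theorem surrCon_self (Q : Problem d m) (i : Fin m) (a : Vec d) : Q.surrCon i a a = Q.ψ i a := by
  simp [surrCon, conModel, ψ]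

/-! ### Optimality conditions of the subproblem and decrease of the objective. -/

/-- A multiplier vector together with first-order optimality of a linearized Lagrangian gives a
decomposition into subgradients of the individual functions. -/
theorem Regular.exists_subgradients (hQ : Q.Regular) {y v : Vec d} (hy : y ∈ Q.dom)
    {l : Vec m} (hl : ∀ i, 0 ≤ l i) {g₀ : Vec d → ℝ} (hg₀ : ConvexOn ℝ Q.dom g₀)
    (h : ∀ w ∈ Q.dom, g₀ y + ∑ i, l i * Q.χ i y ≤
      g₀ w + ∑ i, l i * Q.χ i w + inner ℝ v (w - y)) :
    ∃ (u₀ : Vec d) (u : Fin m → Vec d), v + u₀ + ∑ i, l i • u i = 0 ∧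
      (∀ w ∈ Q.dom, g₀ y + inner ℝ u₀ (w - y) ≤ g₀ w) ∧
      ∀ i, l i ≠ 0 → u i ∈ subdiff (Q.χExt i) y := by
  have hs : ∀ w, ∑ i with l i ≠ 0, l i * Q.χ i w = ∑ i, l i * Q.χ i w := fun w =>
    Finset.sum_filter_of_ne fun i _ hi => left_ne_zero_of_mul hi
  -- The sum rule needs positive weights, so indices with zero multiplier are dropped first, in line
  -- with the convention of `weightedSum`.
  obtain ⟨u₀, u, h1, h2, h3⟩ := exists_subgradients_of_sum hy
    (Finset.univ.filter fun i => l i ≠ 0) (g := Q.χ) (l := l) (v := -v) hg₀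
    (fun i _ => hQ.χ_convex i) (fun i hi => (hl i).lt_of_ne' (Finset.mem_filter.1 hi).2)
    (fun w hw => by
      rw [hs, hs, inner_neg_left]
      linarith [h w hw])
  refine ⟨u₀, u, ?_, h2, fun i hi => ?_⟩
  · have : ∑ i with l i ≠ 0, l i • u i = ∑ i, l i • u i :=
      Finset.sum_filter_of_ne fun i _ hi => left_ne_zero_of_smul hi
    rw [← this, add_assoc, h1, add_neg_cancel]
  · exact (mem_subdiff_χExt hy).2 (h3 i (by simpa using hi))

theorem Regular.surrObj_eq (hQ : Q.Regular) (G : Vec d) (γ : ℝ) (a : Vec d) {w : Vec d}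
    (hw : w ∈ Q.dom) : Q.surrObj G γ a w = ((objModel G γ a w + Q.χ₀Real w : ℝ) : EReal) := by
  rw [surrObj, hQ.coe_χ₀Real hw, EReal.coe_add]

/-- Existence of multipliers of the subproblem at a strictly feasible point. -/
theorem Regular.exists_isSubMultiplier (hQ : Q.Regular) {G : Vec d} {γ : ℝ} (hγ : 0 ≤ γ)
    {e : Fin m → ℝ} {a y : Vec d} (ha : a ∈ Q.dom) (hae : ∀ i, Q.ψ i a < e i)
    (hy : Q.IsSubSolution G γ e a y) : ∃ l : Vec m, Q.IsSubMultiplier G γ e a y l := by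
  have hyD : y ∈ Q.dom := hy.1.1
  have hobj : ConvexOn ℝ Q.dom (fun w => objModel G γ a w + Q.χ₀Real w) := by
    have h := convexOn_quadratic hγ G a 0 hQ.convex_dom
    rw [← objModel_eq] at h
    exact h.add hQ.convexOn_χ₀Real
  -- The center `a` is a Slater point because each surrogate is exact there.
  obtain ⟨l, hl0, hl⟩ := exists_multipliers_of_slater (g := fun i w => Q.surrCon i a w - e i)
    (y := y) hobj (fun i => (hQ.convexOn_surrCon i a).sub (concaveOn_const (e i) hQ.convex_dom)) ha
    (fun i => by simpa [surrCon_self] using hae i)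
    (fun w hw hwe => by
      have := hy.2 w ⟨hw, fun i => sub_nonpos.1 (hwe i)⟩
      rw [hQ.surrObj_eq _ _ _ hyD, hQ.surrObj_eq _ _ _ hw] at this
      exact_mod_cast this)
  have hterm : ∀ i, l i * (Q.surrCon i a y - e i) ≤ 0 := fun i =>
    mul_nonpos_of_nonneg_of_nonpos (hl0 i) (sub_nonpos.2 (hy.1.2 i))
  -- The Lagrangian inequality at `w = y` makes the sum nonnegative, while every term is
  -- nonpositive.
  have hcomp : ∀ i, l i * (Q.surrCon i a y - e i) = 0 := by
    have h1 := hl y hyD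
    have h2 : ∑ i, l i * (Q.surrCon i a y - e i) = 0 :=
      le_antisymm (Finset.sum_nonpos fun i _ => hterm i) (by linarith)
    exact fun i => (Finset.sum_eq_zero_iff_of_nonpos fun i _ => hterm i).1 h2 i (Finset.mem_univ i)
  set p : Vec d := G + γ • (y - a) + ∑ i, l i • (gradient (Q.f i) a + Q.L i • (y - a)) with hp
  have hgrad : HasGradientAt (fun w => objModel G γ a w + ∑ i, l i * Q.conModel i a w) p y := by
    rw [hasGradientAt_iff_hasFDerivAt, hp, map_add, map_sum]
    refine (hasGradientAt_objModel G γ a y).hasFDerivAt.add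
      (HasFDerivAt.fun_sum fun i _ => ?_)
    refine ((hasGradientAt_conModel Q i a y).hasFDerivAt.const_mul (l i)).congr_fderiv ?_
    simp
  have hconv : ConvexOn ℝ Q.dom (fun w => Q.χ₀Real w + ∑ i, l i * Q.χ i w) :=
    hQ.convexOn_χ₀Real.add
      (convexOn_sum_mul hQ.convex_dom _ (fun i _ => hQ.χ_convex i) fun i _ => hl0 i)
  have hlin := linearized_min_of_min hconv hyD hgrad (fun w hw => by
    have h1 := hl w hw
    have h2 : ∑ i, l i * (Q.surrCon i a w - e i) = ∑ i, l i * Q.conModel i a w +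
        ∑ i, l i * Q.χ i w - ∑ i, l i * e i := by
      rw [← Finset.sum_add_distrib, ← Finset.sum_sub_distrib]
      exact Finset.sum_congr rfl fun i _ => by rw [surrCon]; ring
    have h3 : ∑ i, l i * Q.conModel i a y + ∑ i, l i * Q.χ i y - ∑ i, l i * e i = 0 := by
      rw [← Finset.sum_add_distrib, ← Finset.sum_sub_distrib]
      exact Finset.sum_eq_zero fun i _ => by rw [← hcomp i, surrCon]; ring
    linarith)
  obtain ⟨u₀, u, hu, hu₀, hui⟩ := hQ.exists_subgradients (l := WithLp.toLp 2 l) hyD hl0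
    hQ.convexOn_χ₀Real hlin
  refine ⟨WithLp.toLp 2 l, hl0, ⟨_, ⟨u₀, (hQ.mem_subdiff_χ₀ hyD).2 hu₀, rfl⟩,
    fun i => gradient (Q.conModel i a) y + u i, fun i hi => ⟨u i, hui i hi, rfl⟩, ?_⟩, hcomp⟩
  rw [(hasGradientAt_objModel G γ a y).gradient]
  simp only [(hasGradientAt_conModel Q _ a y).gradient]
  rw [← hu, hp]
  simp only [smul_add, Finset.sum_add_distrib]
  abel

/-- First-order optimality of the linearized Lagrangian at multipliers. -/
theorem Regular.le_of_isSubMultiplier (hQ : Q.Regular) {G : Vec d} {γ : ℝ}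
    {e : Fin m → ℝ} {a y : Vec d} {l : Vec m} (hy : y ∈ Q.dom)
    (hl : Q.IsSubMultiplier G γ e a y l) : ∀ w ∈ Q.dom, Q.χ₀Real y + ∑ i, l i * Q.χ i y ≤
      Q.χ₀Real w + ∑ i, l i * Q.χ i w + inner ℝ (G + γ • (y - a) +
        ∑ i, l i • (gradient (Q.f i) a + Q.L i • (y - a))) (w - y) := by
  intro w hw
  obtain ⟨hl0, ⟨_, ⟨u₀, hu₀, rfl⟩, v, hv, hsum⟩, -⟩ := hl
  rw [(hasGradientAt_objModel G γ a y).gradient] at hsum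
  have h0 := (hQ.mem_subdiff_χ₀ hy).1 hu₀ w hw
  -- Weighted subgradient inequalities are summed and stationarity cancels the subgradients. For `l
  -- i = 0` the vector `v i` is arbitrary, but both sides vanish.
  have hi : ∀ i, l i * Q.χ i y + l i * inner ℝ (v i) (w - y) ≤ l i * Q.χ i w +
      l i * inner ℝ (gradient (Q.f i) a + Q.L i • (y - a)) (w - y) := by
    intro i
    rcases eq_or_ne (l i) 0 with h | h
    · simp [h]
    · obtain ⟨u, hu, huv⟩ := hv i h
      rw [(hasGradientAt_conModel Q i a y).gradient] at huv
      have := (mem_subdiff_χExt hy).1 hu w hw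
      rw [← mul_add, ← mul_add, huv, inner_add_left (gradient (Q.f i) a + Q.L i • (y - a))]
      exact mul_le_mul_of_nonneg_left (by linarith) (hl0 i)
  have hs := Finset.sum_le_sum fun i (_ : i ∈ Finset.univ) => hi i
  have h1 : (0 : ℝ) = inner ℝ (G + γ • (y - a) + u₀ + ∑ i, l i • v i) (w - y) := by
    rw [← hsum, inner_zero_left]
  simp only [inner_add_left _ _ (w - y), sum_inner, inner_smul_left, conj_trivial,
    Finset.sum_add_distrib, mul_add] at h1 hs ⊢
  linarith

/-- Sufficient decrease of the surrogate objective. -/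
theorem Regular.surrogate_decrease (hQ : Q.Regular) {G : Vec d} {γ : ℝ} (hγ : 0 ≤ γ)
    {e : Fin m → ℝ} {a y : Vec d} (ha : a ∈ Q.dom) (hae : ∀ i, Q.ψ i a < e i)
    (hy : Q.IsSubSolution G γ e a y) :
    Q.χ₀Real y + inner ℝ G (y - a) + γ * ‖y - a‖ ^ 2 ≤ Q.χ₀Real a := by
  obtain ⟨l, hl⟩ := hQ.exists_isSubMultiplier hγ ha hae hy
  have h := hQ.le_of_isSubMultiplier hy.1.1 hl a ha
  -- Complementarity at `y` and feasibility of `a` give the constraint terms a favorable sign, so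
  -- they can be discarded. What remains has the full coefficient `γ` instead of `γ / 2`.
  have hi : ∀ i, l i * Q.χ i a + l i * inner ℝ (gradient (Q.f i) a + Q.L i • (y - a)) (a - y) ≤
      l i * Q.χ i y := by
    intro i
    have h1 := hl.2.2 i
    have h2 : inner ℝ (gradient (Q.f i) a + Q.L i • (y - a)) (a - y) =
        -(inner ℝ (gradient (Q.f i) a) (y - a) + Q.L i * ‖y - a‖ ^ 2) := by
      rw [← neg_sub y a, inner_neg_right, inner_add_left, inner_smul_left,
        real_inner_self_eq_norm_sq, conj_trivial]
    have h3 : 0 ≤ l i * (e i - Q.ψ i a) := mul_nonneg (hl.1 i) (sub_nonneg.2 (hae i).le)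
    have h4 : 0 ≤ l i * (Q.L i / 2 * ‖y - a‖ ^ 2) :=
      mul_nonneg (hl.1 i) (mul_nonneg (by linarith [(hQ.f_smooth i).1]) (sq_nonneg _))
    rw [surrCon, conModel] at h1
    rw [ψ] at h3
    rw [h2]
    linarith
  have hs := Finset.sum_le_sum fun i (_ : i ∈ Finset.univ) => hi i
  have h2 : inner ℝ (G + γ • (y - a)) (a - y) = -(inner ℝ G (y - a) + γ * ‖y - a‖ ^ 2) := by
    rw [← neg_sub y a, inner_neg_right, inner_add_left, inner_smul_left,
      real_inner_self_eq_norm_sq, conj_trivial]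
  rw [inner_add_left (G + γ • (y - a)), h2] at h
  simp only [sum_inner, inner_smul_left, conj_trivial] at h
  rw [Finset.sum_add_distrib] at hs
  linarith

/-- One-step decrease of the objective up to the gradient error. -/
theorem Regular.objective_decrease (hQ : Q.Regular) {G : Vec d} {γ β : ℝ} (hγ : 0 ≤ γ)
    (hβ : 0 < β) {e : Fin m → ℝ} {a y : Vec d} (ha : a ∈ Q.dom) (hae : ∀ i, Q.ψ i a < e i)
    (hy : Q.IsSubSolution G γ e a y) :
    Q.ψ₀ y + (2 * γ - β - Q.L₀) / 2 * ‖y - a‖ ^ 2 ≤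
      Q.ψ₀ a + (2 * β)⁻¹ * ‖G - gradient Q.f₀ a‖ ^ 2 := by
  have h1 := hQ.surrogate_decrease hγ ha hae hy
  have h2 := descent_of_lipschitz_gradient hQ.convex_dom hQ.f₀_smooth.2.1 hQ.f₀_smooth.2.2 ha hy.1.1
  have h3 := real_inner_le_norm (G - gradient Q.f₀ a) (a - y)
  rw [← neg_sub y a, norm_neg, inner_neg_right, inner_sub_left] at h3
  set n := ‖G - gradient Q.f₀ a‖
  set t := ‖y - a‖
  -- Young's inequality with weight `β` splits the noise from the step.
  have h4 : n * t ≤ (2 * β)⁻¹ * n ^ 2 + β / 2 * t ^ 2 := by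
    have : (2 * β)⁻¹ * n ^ 2 + β / 2 * t ^ 2 - n * t = (2 * β)⁻¹ * (n - β * t) ^ 2 := by
      field_simp
      ring
    have h5 : 0 ≤ (2 * β)⁻¹ * (n - β * t) ^ 2 := by positivity
    linarith
  simp only [ψ₀]
  linarith

/-- The objective is bounded below on the feasible set. -/
theorem Regular.exists_lower_bound (hQ : Q.Regular) : ∃ c : ℝ, ∀ x ∈ Q.feasible, c ≤ Q.ψ₀ x := by
  rcases Q.feasible.eq_empty_or_nonempty with h | hne
  · exact ⟨0, by simp [h]⟩
  · obtain ⟨p, hp, hpm⟩ := LowerSemicontinuousOn.exists_isMinOn hne hQ.feasible_compact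
      (hQ.χ₀_proper.lsc.lowerSemicontinuousOn _)
    obtain ⟨q, hq, hqm⟩ := hQ.feasible_compact.exists_isMinOn hne
      (hQ.f₀_smooth.continuousOn.mono fun x hx => hx.1)
    refine ⟨Q.f₀ q + Q.χ₀Real p, fun x hx => add_le_add (hqm hx) ?_⟩
    have h : Q.χ₀ p ≤ Q.χ₀ x := hpm hx
    rw [hQ.coe_χ₀Real hp.1, hQ.coe_χ₀Real hx.1] at h
    exact_mod_cast h

end Problem

/-! ### Feasibility of the iterates and vanishing steps. -/

/-- A bounded below sequence that decreases by `c * t k` up to a summable error. -/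
theorem tendsto_zero_of_perturbed_decrease {p t z : ℕ → ℝ} {c C B : ℝ} (hc : 0 < c)
    (ht : ∀ k, 0 ≤ t k) (hp : ∀ k, B ≤ p k) (hz : Summable z) (hz0 : ∀ k, 0 ≤ z k) (hC : 0 ≤ C)
    (h : ∀ k, p (k + 1) + c * t k ≤ p k + C * z k) : Tendsto t atTop (𝓝 0) := by
  have hsum : ∀ n, p n + c * ∑ k ∈ Finset.range n, t k ≤
      p 0 + C * ∑ k ∈ Finset.range n, z k := by
    intro n
    induction n with
    | zero => simp
    | succ n ih =>
      rw [Finset.sum_range_succ, Finset.sum_range_succ]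
      linarith [h n]
  refine (summable_of_sum_range_le (c := (p 0 - B + C * ∑' k, z k) / c) ht
    fun n => ?_).tendsto_atTop_zero
  rw [le_div_iff₀ hc]
  have h1 := mul_le_mul_of_nonneg_left (hz.sum_le_tsum (Finset.range n) fun k _ => hz0 k) hC
  linarith [hsum n, hp n]

namespace Problem

variable {d m : ℕ} {Q : Problem d m}

/-- By the descent lemma, feasibility for the subproblem transfers to the original constraints. -/
theorem Regular.surrCon_ge (hQ : Q.Regular) (i : Fin m) {a y : Vec d} (ha : a ∈ Q.dom)
    (hy : y ∈ Q.dom) : Q.ψ i y ≤ Q.surrCon i a y :=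
  add_le_add (descent_of_lipschitz_gradient hQ.convex_dom (hQ.f_smooth i).2.1
    (hQ.f_smooth i).2.2 ha hy) le_rfl

/-- Along the iterations every point is strictly feasible for the next subproblem. -/
theorem Regular.strictly_feasible (hQ : Q.Regular) {x₀ : Vec d} {e δ : ℕ → Fin m → ℝ}
    (he : IsLevelSchedule Q x₀ e δ) {G : ℕ → Vec d} {γ : ℕ → ℝ} {x : ℕ → Vec d} (h0 : x 0 = x₀)
    (hx : ∀ k, Q.IsSubSolution (G k) (γ k) (e k) (x k) (x (k + 1))) (k : ℕ) :
    x k ∈ Q.dom ∧ ∀ i, Q.ψ i (x k) < e k i := by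
  induction k with
  | zero => exact h0 ▸ ⟨he.mem_dom, fun i => (he.strict i).1⟩
  | succ k ih =>
    refine ⟨(hx k).1.1, fun i => ?_⟩
    -- The new point meets level `e k`; the positive increment `δ k i` turns this into strict
    -- feasibility at level `e (k + 1)`.
    have h1 := hQ.surrCon_ge i ih.1 (hx k).1.1
    have h2 := (hx k).1.2 i
    have h3 := (he.update k i).1
    linarith [he.step_pos k i]

theorem _root_.LevelConstrained.IsLevelSchedule.lt {x₀ : Vec d} {e δ : ℕ → Fin m → ℝ}
    (he : IsLevelSchedule Q x₀ e δ) (k : ℕ) (i : Fin m) : e k i < Q.η i := by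
  cases k with
  | zero => exact (he.strict i).2
  | succ k => exact (he.update k i).2

theorem Regular.mem_feasible (hQ : Q.Regular) {x₀ : Vec d} {e δ : ℕ → Fin m → ℝ}
    (he : IsLevelSchedule Q x₀ e δ) {G : ℕ → Vec d} {γ : ℕ → ℝ} {x : ℕ → Vec d} (h0 : x 0 = x₀)
    (hx : ∀ k, Q.IsSubSolution (G k) (γ k) (e k) (x k) (x (k + 1))) (k : ℕ) :
    x k ∈ Q.feasible :=
  have h := hQ.strictly_feasible he h0 hx k
  ⟨h.1, fun i => ((h.2 i).trans (he.lt k i)).le⟩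

/-- Vanishing steps when the gradient errors are square summable. -/
theorem Regular.tendsto_step (hQ : Q.Regular) {x₀ : Vec d} {e δ : ℕ → Fin m → ℝ}
    (he : IsLevelSchedule Q x₀ e δ) {G : ℕ → Vec d} {γ : ℕ → ℝ} {x : ℕ → Vec d} (h0 : x 0 = x₀)
    (hx : ∀ k, Q.IsSubSolution (G k) (γ k) (e k) (x k) (x (k + 1))) {β₀ : ℝ} (hβ₀ : 0 < β₀)
    (hγ : ∀ k, β₀ + Q.L₀ ≤ 2 * γ k)
    (hG : Summable fun k => ‖G k - gradient Q.f₀ (x k)‖ ^ 2) :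
    Tendsto (fun k => ‖x (k + 1) - x k‖) atTop (𝓝 0) := by
  obtain ⟨B, hB⟩ := hQ.exists_lower_bound
  have hL := hQ.f₀_smooth.1
  -- The margin `2γ - β - L₀` is only known to be positive, not bounded away from 0. Young's
  -- inequality is therefore used with `β₀ / 2`, which leaves a decrease coefficient of at least `β₀
  -- / 4`.
  have h := tendsto_zero_of_perturbed_decrease (p := fun k => Q.ψ₀ (x k))
    (t := fun k => ‖x (k + 1) - x k‖ ^ 2) (z := fun k => ‖G k - gradient Q.f₀ (x k)‖ ^ 2)
    (c := β₀ / 4) (C := (2 * (β₀ / 2))⁻¹) (B := B) (by positivity) (fun k => sq_nonneg _)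
    (fun k => hB _ (hQ.mem_feasible he h0 hx k)) hG (fun k => sq_nonneg _) (by positivity)
    (fun k => by
      have hs := hQ.strictly_feasible he h0 hx k
      refine le_trans ?_ (hQ.objective_decrease (β := β₀ / 2) (by linarith [hγ k])
        (half_pos hβ₀) hs.1 hs.2 (hx k))
      have : β₀ / 4 ≤ (2 * γ k - β₀ / 2 - Q.L₀) / 2 := by linarith [hγ k]
      gcongr)
  have h2 := h.sqrt
  simpa using h2

/-! ### Limits of optimality conditions and the role of MFCQ. -/

/-- Passage to the limit in the optimality conditions of the subproblems, for scaled
multipliers. -/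
theorem Regular.limit_optimality (hQ : Q.Regular) {a b G : ℕ → Vec d} {γ s : ℕ → ℝ}
    {e : ℕ → Fin m → ℝ} {l : ℕ → Vec m}
    (hl : ∀ n, Q.IsSubMultiplier (G n) (γ n) (e n) (a n) (b n) (l n))
    (haD : ∀ n, a n ∈ Q.dom) (hbD : ∀ n, b n ∈ Q.dom) (hs : ∀ n, 0 ≤ s n) {y g : Vec d}
    {s' : ℝ} {lam : Vec m} (hy : y ∈ Q.dom) (ha : Tendsto a atTop (𝓝 y))
    (hb : Tendsto b atTop (𝓝 y)) (hG : Tendsto G atTop (𝓝 g))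
    (hγ : Tendsto (fun n => γ n • (b n - a n)) atTop (𝓝 0)) (hs' : Tendsto s atTop (𝓝 s'))
    (he : ∀ i, Tendsto (fun n => e n i) atTop (𝓝 (Q.η i)))
    (hlam : Tendsto (fun n => s n • l n) atTop (𝓝 lam)) :
    (∀ i, 0 ≤ lam i) ∧ (∀ i, lam i * (Q.ψ i y - Q.η i) = 0) ∧
    ∀ w ∈ Q.dom, s' * Q.χ₀Real y + ∑ i, lam i * Q.χ i y ≤
      s' * Q.χ₀Real w + ∑ i, lam i * Q.χ i w +
        inner ℝ (s' • g + ∑ i, lam i • gradient (Q.f i) y) (w - y) := by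
  have hcoord : ∀ i, Tendsto (fun n => s n * l n i) atTop (𝓝 (lam i)) := fun i => by
    simpa [Function.comp_def] using ((EuclideanSpace.proj (𝕜 := ℝ) i).continuous.tendsto lam).comp hlam
  have haW : Tendsto a atTop (𝓝[Q.dom] y) :=
    tendsto_nhdsWithin_iff.2 ⟨ha, Eventually.of_forall haD⟩
  have hbW : Tendsto b atTop (𝓝[Q.dom] y) :=
    tendsto_nhdsWithin_iff.2 ⟨hb, Eventually.of_forall hbD⟩
  have hχ : ∀ i, Tendsto (fun n => Q.χ i (b n)) atTop (𝓝 (Q.χ i y)) := fun i =>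
    (hQ.χ_cont i y hy).tendsto.comp hbW
  have hgr : ∀ i, Tendsto (fun n => gradient (Q.f i) (a n)) atTop (𝓝 (gradient (Q.f i) y)) :=
    fun i => ((hQ.f_smooth i).continuousOn_gradient y hy).tendsto.comp haW
  have hf : ∀ i, Tendsto (fun n => Q.f i (a n)) atTop (𝓝 (Q.f i y)) :=
    fun i => ((hQ.f_smooth i).continuousOn y hy).tendsto.comp haW
  have hd : Tendsto (fun n => b n - a n) atTop (𝓝 0) := by simpa using hb.sub ha
  refine ⟨fun i => ?_, fun i => ?_, fun w hw => ?_⟩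
  · exact ge_of_tendsto' (hcoord i) fun n => mul_nonneg (hs n) ((hl n).1 i)
  · have hcon : Tendsto (fun n => Q.surrCon i (a n) (b n)) atTop (𝓝 (Q.ψ i y)) := by
      have h := (((hf i).add ((hgr i).inner hd)).add
        ((hd.norm.pow 2).const_mul (Q.L i / 2))).add (hχ i)
      simpa [surrCon, conModel, ψ] using h
    have h1 := (hcoord i).mul (hcon.sub (he i))
    refine tendsto_nhds_unique h1 ?_
    have : (fun n => s n * l n i * (Q.surrCon i (a n) (b n) - e n i)) = fun _ => 0 := by
      ext n
      rw [mul_assoc, (hl n).2.2 i, mul_zero]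
    rw [this]
    exact tendsto_const_nhds
  -- Only the term with `χ₀` at `b n` may fail to converge, since `χ₀` is merely lower
  -- semicontinuous. It is isolated on the left, and `R` collects the convergent rest.
  · set R : ℕ → ℝ := fun n => s n * Q.χ₀Real w + ∑ i, (s n * l n i) * Q.χ i w +
      inner ℝ (s n • (G n + γ n • (b n - a n)) + ∑ i, (s n * l n i) •
        (gradient (Q.f i) (a n) + Q.L i • (b n - a n))) (w - b n) -
      ∑ i, (s n * l n i) * Q.χ i (b n) with hR
    have hRle : ∀ n, s n * Q.χ₀Real (b n) ≤ R n := by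
      intro n
      have h := mul_le_mul_of_nonneg_left (hQ.le_of_isSubMultiplier (hbD n) (hl n) w hw) (hs n)
      rw [mul_add, mul_add, mul_add, ← real_inner_smul_left, smul_add, Finset.mul_sum,
        Finset.mul_sum, Finset.smul_sum] at h
      simp only [smul_smul, ← mul_assoc] at h
      simp only [hR]
      linarith
    have hRlim : Tendsto R atTop (𝓝 (s' * Q.χ₀Real w + ∑ i, lam i * Q.χ i w +
        inner ℝ (s' • g + ∑ i, lam i • gradient (Q.f i) y) (w - y) -
        ∑ i, lam i * Q.χ i y)) := by
      have h1 := tendsto_finsetSum Finset.univ fun i (_ : i ∈ Finset.univ) =>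
        (hcoord i).mul_const (Q.χ i w)
      have h2 := tendsto_finsetSum Finset.univ fun i (_ : i ∈ Finset.univ) =>
        (hcoord i).mul (hχ i)
      have h3 := tendsto_finsetSum Finset.univ fun i (_ : i ∈ Finset.univ) =>
        (hcoord i).smul ((hgr i).add (hd.const_smul (Q.L i)))
      have h4 := ((hs'.smul (hG.add hγ)).add h3).inner (𝕜 := ℝ)
        ((tendsto_const_nhds (x := w)).sub hb)
      simp only [smul_zero, add_zero] at h4
      exact (((hs'.mul_const (Q.χ₀Real w)).add h1).add h4).sub h2
    -- Fixed lower bounds `c` are used before letting `c` increase to the value at `y`. This also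
    -- covers `s' = 0` without any upper bound on `χ₀` along `b`.
    have hlsc : ∀ c < Q.χ₀Real y, s' * c ≤ s' * Q.χ₀Real w + ∑ i, lam i * Q.χ i w +
        inner ℝ (s' • g + ∑ i, lam i • gradient (Q.f i) y) (w - y) -
        ∑ i, lam i * Q.χ i y := by
      intro c hc
      refine le_of_tendsto_of_tendsto (hs'.mul_const c) hRlim ?_
      have h1 : ((c : ℝ) : EReal) < Q.χ₀ y := by
        rw [hQ.coe_χ₀Real hy]
        exact_mod_cast hc
      filter_upwards [hb.eventually (hQ.χ₀_proper.lsc y _ h1)] with n hn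
      rw [hQ.coe_χ₀Real (hbD n)] at hn
      exact (mul_le_mul_of_nonneg_left (EReal.coe_lt_coe_iff.1 hn).le (hs n)).trans (hRle n)
    have hfin : s' * Q.χ₀Real y ≤ s' * Q.χ₀Real w + ∑ i, lam i * Q.χ i w +
        inner ℝ (s' • g + ∑ i, lam i • gradient (Q.f i) y) (w - y) -
        ∑ i, lam i * Q.χ i y := by
      have h1 : Tendsto (fun c : ℝ => s' * c) (𝓝[<] (Q.χ₀Real y)) (𝓝 (s' * Q.χ₀Real y)) :=
        ((continuous_const.mul continuous_id).tendsto _).mono_left nhdsWithin_le_nhds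
      exact le_of_tendsto h1 (eventually_nhdsWithin_of_forall fun c hc => hlsc c hc)
    linarith

/-- A limit point of the optimality conditions with unscaled multipliers is a KKT point. -/
theorem Regular.isKKT_of_limit (hQ : Q.Regular) {y : Vec d} (hy : y ∈ Q.feasible) {lam : Vec m}
    (h0 : ∀ i, 0 ≤ lam i) (hc : ∀ i, lam i * (Q.ψ i y - Q.η i) = 0)
    (h : ∀ w ∈ Q.dom, Q.χ₀Real y + ∑ i, lam i * Q.χ i y ≤
      Q.χ₀Real w + ∑ i, lam i * Q.χ i w +
        inner ℝ (gradient Q.f₀ y + ∑ i, lam i • gradient (Q.f i) y) (w - y)) : Q.IsKKT y := by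
  obtain ⟨u₀, u, hu, hu₀, hui⟩ := hQ.exists_subgradients hy.1 h0 hQ.convexOn_χ₀Real h
  refine ⟨hy, lam, h0, ⟨_, ⟨u₀, (hQ.mem_subdiff_χ₀ hy.1).2 hu₀, rfl⟩,
    fun i => gradient (Q.f i) y + u i, fun i hi => ⟨u i, hui i hi, rfl⟩, ?_⟩,
    Finset.sum_eq_zero fun i _ => hc i⟩
  rw [← hu]
  simp only [smul_add, Finset.sum_add_distrib]
  abel

/-- Under MFCQ there is no nontrivial multiplier of the constraints alone. -/
theorem Regular.eq_zero_of_mfcq (hQ : Q.Regular) {y : Vec d} (hy : y ∈ Q.dom) (hm : Q.MFCQ y)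
    {lam : Vec m} (h0 : ∀ i, 0 ≤ lam i) (hc : ∀ i, lam i * (Q.ψ i y - Q.η i) = 0)
    (h : ∀ w ∈ Q.dom, ∑ i, lam i * Q.χ i y ≤ ∑ i, lam i * Q.χ i w +
        inner ℝ (∑ i, lam i • gradient (Q.f i) y) (w - y)) : lam = 0 := by
  obtain ⟨z, hz, hzi⟩ := hm
  -- With zero objective, `u₀` is a normal vector of the domain, so its product with `z` is
  -- nonpositive. Complementarity makes every index with nonzero multiplier active, hence strictly
  -- negative against `z`; the total is zero only if no such index exists.
  obtain ⟨u₀, u, hu, hu₀, hui⟩ := hQ.exists_subgradients hy h0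
    (convexOn_const (0 : ℝ) hQ.convex_dom) (by simpa using h)
  have h1 : inner ℝ u₀ z ≤ (0 : ℝ) := by
    have := ProperCone.mem_innerDual.1 hz (x := u₀) fun w hw => by simpa using hu₀ w hw
    rw [inner_neg_right] at this
    linarith
  have hterm : ∀ i, lam i ≠ 0 → inner ℝ (gradient (Q.f i) y + u i) z < (0 : ℝ) := fun i hi =>
    hzi i (sub_eq_zero.1 ((mul_eq_zero.1 (hc i)).resolve_left hi)) _ ⟨u i, hui i hi, rfl⟩
  have h2 : inner ℝ u₀ z + ∑ i, lam i * inner ℝ (gradient (Q.f i) y + u i) z = (0 : ℝ) := by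
    have := congrArg (fun v => inner ℝ v z) hu
    simp only [inner_add_left, sum_inner, real_inner_smul_left, inner_zero_left] at this
    simp only [inner_add_left, mul_add, Finset.sum_add_distrib]
    linarith
  have hle : ∀ i ∈ Finset.univ, lam i * inner ℝ (gradient (Q.f i) y + u i) z ≤ (0 : ℝ) := by
    intro i _
    rcases eq_or_ne (lam i) 0 with hi | hi
    · simp [hi]
    · exact mul_nonpos_of_nonneg_of_nonpos (h0 i) (hterm i hi).le
  have h3 : ∑ i, lam i * inner ℝ (gradient (Q.f i) y + u i) z = (0 : ℝ) :=
    le_antisymm (Finset.sum_nonpos hle) (by linarith)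
  ext i
  by_contra hi
  have hi' : lam i ≠ 0 := hi
  exact (mul_eq_zero.1 ((Finset.sum_eq_zero_iff_of_nonpos hle).1 h3 i (Finset.mem_univ i))).elim
    hi' (hterm i hi').ne

/-! ### Bounded multipliers and KKT limit points along one trajectory. -/

section Trajectory

variable {x₀ : Vec d} {e δ : ℕ → Fin m → ℝ} {G : ℕ → Vec d} {γ : ℕ → ℝ} {x : ℕ → Vec d}
  {Γ : ℝ}

/-- The optimality conditions along a convergent subsequence of the iterates. -/
theorem Regular.subsequence_optimality (hQ : Q.Regular)
    (he : IsLevelSchedule Q x₀ e δ) (h0 : x 0 = x₀)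
    (hx : ∀ k, Q.IsSubSolution (G k) (γ k) (e k) (x k) (x (k + 1)))
    (hγ0 : ∀ k, 0 ≤ γ k) (hΓ : ∀ k, γ k ≤ Γ)
    (hstep : Tendsto (fun k => ‖x (k + 1) - x k‖) atTop (𝓝 0))
    (hG : Tendsto (fun k => G k - gradient Q.f₀ (x k)) atTop (𝓝 0)) {l : ℕ → Vec m}
    (hl : ∀ k, Q.IsSubMultiplier (G k) (γ k) (e k) (x k) (x (k + 1)) (l k))
    {φ : ℕ → ℕ} (hφ : Tendsto φ atTop atTop) {y : Vec d} (hxφ : Tendsto (x ∘ φ) atTop (𝓝 y))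
    {s : ℕ → ℝ} (hs : ∀ n, 0 ≤ s n) {s' : ℝ} (hs' : Tendsto s atTop (𝓝 s')) {lam : Vec m}
    (hlam : Tendsto (fun n => s n • l (φ n)) atTop (𝓝 lam)) :
    y ∈ Q.feasible ∧ (∀ i, 0 ≤ lam i) ∧ (∀ i, lam i * (Q.ψ i y - Q.η i) = 0) ∧
    ∀ w ∈ Q.dom, s' * Q.χ₀Real y + ∑ i, lam i * Q.χ i y ≤
      s' * Q.χ₀Real w + ∑ i, lam i * Q.χ i w +
        inner ℝ (s' • gradient Q.f₀ y + ∑ i, lam i • gradient (Q.f i) y) (w - y) := by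
  have hfeas := hQ.mem_feasible he h0 hx
  have hy : y ∈ Q.feasible :=
    hQ.feasible_compact.isClosed.mem_of_tendsto hxφ (Eventually.of_forall fun n => hfeas _)
  have hd : Tendsto (fun n => x (φ n + 1) - x (φ n)) atTop (𝓝 0) :=
    tendsto_zero_iff_norm_tendsto_zero.2 (hstep.comp hφ)
  have hb : Tendsto (fun n => x (φ n + 1)) atTop (𝓝 y) := by
    simpa using hd.add hxφ
  refine ⟨hy, hQ.limit_optimality (fun n => hl (φ n)) (fun n => (hfeas _).1)
    (fun n => (hfeas _).1) hs hy.1 hxφ hb ?_ ?_ hs' (fun i => (he.tendsto i).comp hφ) hlam⟩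
  · have h1 : Tendsto (fun n => gradient Q.f₀ (x (φ n))) atTop (𝓝 (gradient Q.f₀ y)) :=
      (hQ.f₀_smooth.continuousOn_gradient y hy.1).tendsto.comp
        (tendsto_nhdsWithin_iff.2 ⟨hxφ, Eventually.of_forall fun n => (hfeas _).1⟩)
    simpa using (hG.comp hφ).add h1
  -- Boundedness of `γ` is what makes the proximal term vanish with the steps.
  · refine squeeze_zero_norm (a := fun n => Γ * ‖x (φ n + 1) - x (φ n)‖) (fun n => ?_) ?_
    · rw [norm_smul, Real.norm_of_nonneg (hγ0 _)]
      exact mul_le_mul_of_nonneg_right (hΓ _) (norm_nonneg _)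
    · simpa using hd.norm.const_mul Γ

/-- Boundedness of the multipliers under uniform MFCQ. -/
theorem Regular.multipliers_bounded (hQ : Q.Regular) (hm : Q.UniformMFCQ)
    (he : IsLevelSchedule Q x₀ e δ) (h0 : x 0 = x₀)
    (hx : ∀ k, Q.IsSubSolution (G k) (γ k) (e k) (x k) (x (k + 1)))
    (hγ0 : ∀ k, 0 ≤ γ k) (hΓ : ∀ k, γ k ≤ Γ)
    (hstep : Tendsto (fun k => ‖x (k + 1) - x k‖) atTop (𝓝 0))
    (hG : Tendsto (fun k => G k - gradient Q.f₀ (x k)) atTop (𝓝 0)) {l : ℕ → Vec m}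
    (hl : ∀ k, Q.IsSubMultiplier (G k) (γ k) (e k) (x k) (x (k + 1)) (l k)) :
    ∃ B : ℝ, ∀ k, ‖l k‖ ≤ B := by
  by_contra hB
  have hfreq : ∀ n : ℕ, ∃ᶠ k in atTop, (n : ℝ) + 1 < ‖l k‖ := by
    intro n hn
    have hbd : IsBoundedUnder (· ≤ ·) atTop fun k => ‖l k‖ :=
      ⟨n + 1, by simpa using hn⟩
    obtain ⟨B, hB'⟩ := hbd.bddAbove_range
    exact hB ⟨B, fun k => hB' ⟨k, rfl⟩⟩
  obtain ⟨φ, hφ, hφl⟩ := extraction_forall_of_frequently hfreq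
  have hpos : ∀ n, 0 < ‖l (φ n)‖ := fun n => by
    have := hφl n
    have : (0 : ℝ) ≤ n := n.cast_nonneg
    linarith
  -- Iterates and normalized multipliers converge along a common subsequence. The scaling `‖l‖⁻¹`
  -- tends to 0 and removes the objective in the limit, while `lam` keeps norm 1.
  obtain ⟨⟨y, lam⟩, hmem, θ, hθ, hlim⟩ := (hQ.feasible_compact.prod
    (isCompact_sphere (0 : Vec m) 1)).tendsto_subseq
    (x := fun n => (x (φ n), ‖l (φ n)‖⁻¹ • l (φ n))) (fun n =>
      ⟨hQ.mem_feasible he h0 hx _, by simp [norm_smul, (hpos n).ne']⟩)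
  have hs : Tendsto (fun n => ‖l (φ (θ n))‖⁻¹) atTop (𝓝 0) := by
    have h1 : Tendsto (fun n => ‖l (φ n)‖) atTop atTop :=
      tendsto_atTop_mono (fun n => by linarith [hφl n]) tendsto_natCast_atTop_atTop
    exact (tendsto_inv_atTop_zero.comp h1).comp hθ.tendsto_atTop
  obtain ⟨hy, hlam0, hc, hopt⟩ := hQ.subsequence_optimality he h0 hx hγ0 hΓ hstep hG hl
    (hφ.tendsto_atTop.comp hθ.tendsto_atTop) ((continuous_fst.tendsto _).comp hlim)
    (fun n => inv_nonneg.2 (norm_nonneg _)) hs ((continuous_snd.tendsto _).comp hlim)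
  have hzero := hQ.eq_zero_of_mfcq hy.1 (hm y hy) hlam0 hc (by simpa using hopt)
  have h1 : ‖lam‖ = 1 := by simpa using hmem.2
  rw [show lam = 0 from hzero, norm_zero] at h1
  exact zero_ne_one h1

/-- Limit points are KKT points when the multipliers are bounded. -/
theorem Regular.isKKT_of_mapClusterPt (hQ : Q.Regular)
    (he : IsLevelSchedule Q x₀ e δ) (h0 : x 0 = x₀)
    (hx : ∀ k, Q.IsSubSolution (G k) (γ k) (e k) (x k) (x (k + 1)))
    (hγ0 : ∀ k, 0 ≤ γ k) (hΓ : ∀ k, γ k ≤ Γ)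
    (hstep : Tendsto (fun k => ‖x (k + 1) - x k‖) atTop (𝓝 0))
    (hG : Tendsto (fun k => G k - gradient Q.f₀ (x k)) atTop (𝓝 0)) {l : ℕ → Vec m}
    (hl : ∀ k, Q.IsSubMultiplier (G k) (γ k) (e k) (x k) (x (k + 1)) (l k))
    {B : ℝ} (hB : ∀ k, ‖l k‖ ≤ B) {y : Vec d} (hy : MapClusterPt y atTop x) : Q.IsKKT y := by
  obtain ⟨φ, hφ, hxφ⟩ := hy.tendsto_subseq
  obtain ⟨lam, -, θ, hθ, hlam⟩ := (isCompact_closedBall (0 : Vec m) B).tendsto_subseq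
    (x := fun n => l (φ n)) (fun n => by simpa using hB (φ n))
  obtain ⟨hyf, hlam0, hc, hopt⟩ := hQ.subsequence_optimality he h0 hx hγ0 hΓ hstep hG hl
    (hφ.tendsto_atTop.comp hθ.tendsto_atTop) (hxφ.comp hθ.tendsto_atTop)
    (s := fun _ => 1) (fun _ => zero_le_one) tendsto_const_nhds
    (by simpa [Function.comp_def] using hlam)
  exact hQ.isKKT_of_limit hyf hlam0 hc (by simpa using hopt)

end Trajectory

end Problem

/-! ### Variance of minibatch gradients and summability of the errors. -/

/-- The mean of `n` pairwise independent centered random vectors with second moment at most `C`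
has second moment at most `C / n`. -/
theorem lintegral_norm_sq_mean_le {d : ℕ} {Ω : Type*} [MeasurableSpace Ω] {μ : Measure Ω}
    [IsProbabilityMeasure μ] {ι : Type*} [Fintype ι] [Nonempty ι] {Z : ι → Ω → Vec d} {C : ℝ}
    (hZ : ∀ i, Measurable (Z i)) (hind : Pairwise fun i j => IndepFun (Z i) (Z j) μ)
    (hmean : ∀ i, ∫ ω, Z i ω ∂μ = 0) (hsq : ∀ i, Integrable (fun ω => ‖Z i ω‖ ^ 2) μ)
    (hC : ∀ i, ∫ ω, ‖Z i ω‖ ^ 2 ∂μ ≤ C) :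
    ∫⁻ ω, ENNReal.ofReal (‖(Fintype.card ι : ℝ)⁻¹ • ∑ i, Z i ω‖ ^ 2) ∂μ ≤
      ENNReal.ofReal (C * (Fintype.card ι : ℝ)⁻¹) := by
  have hL : ∀ i, MemLp (Z i) 2 μ := fun i =>
    (memLp_two_iff_integrable_sq_norm (hZ i).aestronglyMeasurable).2 (hsq i)
  have hcoordM : ∀ i j, Measurable fun ω => Z i ω j := fun i j =>
    (EuclideanSpace.proj (𝕜 := ℝ) j).continuous.measurable.comp (hZ i)
  have hcoord : ∀ i j, MemLp (fun ω => Z i ω j) 2 μ := fun i j =>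
    (hL i).of_le (hcoordM i j).aestronglyMeasurable
      (Eventually.of_forall fun ω => PiLp.norm_apply_le (Z i ω) j)
  have hcmean : ∀ i j, ∫ ω, Z i ω j ∂μ = 0 := by
    intro i j
    have h := (EuclideanSpace.proj (𝕜 := ℝ) j).integral_comp_comm
      ((hL i).integrable one_le_two)
    rw [hmean i, map_zero] at h
    exact h
  have hWL : ∀ j, MemLp (fun ω => ∑ i, Z i ω j) 2 μ := fun j =>
    memLp_finsetSum Finset.univ fun i _ => hcoord i j
  -- In each coordinate, second moments of centered variables are variances, which add under
  -- pairwise independence.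
  have hvar : ∀ j, ∫ ω, (∑ i, Z i ω j) ^ 2 ∂μ = ∑ i, ∫ ω, (Z i ω j) ^ 2 ∂μ := by
    intro j
    have h1 := IndepFun.variance_sum (s := Finset.univ) (X := fun i ω => Z i ω j)
      (fun i _ => hcoord i j) (fun i _ i' _ hii => (hind hii).comp
        (EuclideanSpace.proj (𝕜 := ℝ) j).continuous.measurable
        (EuclideanSpace.proj (𝕜 := ℝ) j).continuous.measurable)
    have h2 : (∑ i, fun ω => Z i ω j) = fun ω => ∑ i, Z i ω j := by
      ext ω
      simp
    rw [h2, variance_of_integral_eq_zero (hWL j).aemeasurable] at h1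
    · rw [h1]
      exact Finset.sum_congr rfl fun i _ =>
        variance_of_integral_eq_zero (hcoordM i j).aemeasurable (hcmean i j)
    · rw [integral_finsetSum _ fun i _ => (hcoord i j).integrable one_le_two]
      exact Finset.sum_eq_zero fun i _ => hcmean i j
  have hnorm : ∀ v : Vec d, ‖v‖ ^ 2 = ∑ j, v j ^ 2 := fun v => by
    simp [EuclideanSpace.norm_sq_eq]
  set n : ℝ := (Fintype.card ι : ℝ) with hn
  have hn0 : 0 < n := by
    rw [hn]
    exact_mod_cast Fintype.card_pos
  have hexp : ∀ ω, ‖n⁻¹ • ∑ i, Z i ω‖ ^ 2 = (n⁻¹) ^ 2 * ∑ j, (∑ i, Z i ω j) ^ 2 := by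
    intro ω
    rw [norm_smul, mul_pow, hnorm (∑ i, Z i ω), Real.norm_eq_abs, sq_abs]
    simp
  have hint : Integrable (fun ω => ‖n⁻¹ • ∑ i, Z i ω‖ ^ 2) μ := by
    simp only [hexp]
    exact (integrable_finsetSum _ fun j _ => (hWL j).integrable_sq).const_mul _
  rw [← ofReal_integral_eq_lintegral_ofReal hint (Eventually.of_forall fun ω => sq_nonneg _)]
  apply ENNReal.ofReal_le_ofReal
  simp only [hexp]
  rw [integral_const_mul, integral_finsetSum _ fun j _ => (hWL j).integrable_sq]
  simp only [hvar]
  rw [Finset.sum_comm]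
  have h3 : ∀ i, ∑ j, ∫ ω, (Z i ω j) ^ 2 ∂μ ≤ C := by
    intro i
    rw [← integral_finsetSum _ fun j _ => (hcoord i j).integrable_sq]
    simpa only [hnorm] using hC i
  have h4 : ∑ i, ∑ j, ∫ ω, (Z i ω j) ^ 2 ∂μ ≤ n * C := by
    refine (Finset.sum_le_sum fun i _ => h3 i).trans ?_
    simp [hn]
  calc (n⁻¹) ^ 2 * ∑ i, ∑ j, ∫ ω, (Z i ω j) ^ 2 ∂μ ≤ (n⁻¹) ^ 2 * (n * C) := by gcongr
    _ = C * n⁻¹ := by field_simp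

section Sampling

variable {d : ℕ} {Ω S : Type*} [MeasurableSpace Ω] [MeasurableSpace S] {μ : Measure Ω}
  {P : Measure S} {b : ℕ → ℕ}
  {ξ : (k : ℕ) → Fin (b k) → Ω → S} {F : Vec d → S → ℝ} {f₀ : Vec d → ℝ} {D : Set (Vec d)}
  {σ : ℝ}

theorem IsSampling.pastSigma_le (hξ : IsSampling μ P b ξ) (k : ℕ) :
    pastSigma b ξ k ≤ (inferInstance : MeasurableSpace Ω) :=
  iSup_le fun j => iSup_le fun i => (hξ.measurable j i).comap_le

/-- A random variable depending on the past minibatches is independent of the current one. -/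
theorem IsSampling.indepFun_past (hξ : IsSampling μ P b ξ) {k : ℕ} {X : Ω → Vec d}
    (hX : Measurable[pastSigma b ξ k] X) : IndepFun X (fun ω i => ξ k i ω) μ := by
  set mm : (Σ k : ℕ, Fin (b k)) → MeasurableSpace Ω := fun q =>
    MeasurableSpace.comap (ξ q.1 q.2) inferInstance with hmm
  -- Past samples and current samples form disjoint index sets of one independent family, so the
  -- σ-algebras they generate are independent.
  have hdisj : Disjoint {q : Σ k : ℕ, Fin (b k) | q.1 < k} {q | q.1 = k} := by
    rw [Set.disjoint_left]
    intro q h1 h2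
    exact (ne_of_lt h1) h2
  have h := indep_iSup_of_disjoint (m := mm) (fun q => (hξ.measurable q.1 q.2).comap_le)
    hξ.indep hdisj
  have h1 : pastSigma b ξ k ≤ ⨆ q ∈ {q : Σ k : ℕ, Fin (b k) | q.1 < k}, mm q :=
    iSup_le fun j => iSup_le fun i =>
      le_iSup₂_of_le (f := fun q (_ : q ∈ {q : Σ k : ℕ, Fin (b k) | q.1 < k}) => mm q)
        ⟨j, i⟩ j.2 le_rfl
  have h2 : MeasurableSpace.comap (fun ω i => ξ k i ω) MeasurableSpace.pi ≤
      ⨆ q ∈ {q : Σ k : ℕ, Fin (b k) | q.1 = k}, mm q := by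
    rw [MeasurableSpace.pi, MeasurableSpace.comap_iSup]
    refine iSup_le fun i => ?_
    rw [MeasurableSpace.comap_comp]
    exact le_iSup₂_of_le (f := fun q (_ : q ∈ {q : Σ k : ℕ, Fin (b k) | q.1 = k}) => mm q)
      ⟨k, i⟩ rfl le_rfl
  rw [IndepFun_iff_Indep]
  exact indep_of_indep_of_le_left (indep_of_indep_of_le_right h h2) (hX.comap_le.trans h1)

variable [IsProbabilityMeasure P]

/-- Variance of the minibatch gradient at a deterministic point. -/
theorem IsSampling.lintegral_batchGrad_le [IsProbabilityMeasure μ] (hξ : IsSampling μ P b ξ) (hF : IsOracle F P f₀ D σ)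
    (k : ℕ) {p : Vec d} (hp : p ∈ D) :
    ∫⁻ ω, ENNReal.ofReal (‖batchGrad F b ξ k p ω - gradient f₀ p‖ ^ 2) ∂μ ≤
      ENNReal.ofReal (σ ^ 2 * (b k : ℝ)⁻¹) := by
  have hb : (b k : ℝ) ≠ 0 := Nat.cast_ne_zero.2 (hξ.size_pos k).ne'
  have : Nonempty (Fin (b k)) := ⟨⟨0, hξ.size_pos k⟩⟩
  have hm : Measurable fun s => stochGrad F p s - gradient f₀ p :=
    (hF.measurable_grad.comp measurable_prodMk_left).sub_const _
  have hlaw : ∀ i, Measure.map (ξ k i) μ = P := hξ.law k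
  have hM := hξ.measurable k
  have h := lintegral_norm_sq_mean_le (μ := μ) (C := σ ^ 2)
    (Z := fun i ω => stochGrad F p (ξ k i ω) - gradient f₀ p)
    (fun i => hm.comp (hM i))
    (fun i j hij => (hξ.indep.indepFun (i := ⟨k, i⟩) (j := ⟨k, j⟩)
      (by simpa using hij)).comp hm hm)
    (fun i => by
      rw [← integral_map (hM i).aemeasurable hm.aestronglyMeasurable, hlaw,
        integral_sub (hF.integrable_grad p hp) (integrable_const _), hF.unbiased p hp]
      simp)
    (fun i => by
      have := hF.integrable_sq p hp
      rw [← hlaw i] at this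
      exact this.comp_measurable (hM i))
    (fun i => by
      rw [← integral_map (hM i).aemeasurable (f := fun s => ‖stochGrad F p s - gradient f₀ p‖ ^ 2)
        (hm.norm.pow_const 2).aestronglyMeasurable, hlaw]
      exact hF.variance_le p hp)
  rw [Fintype.card_fin] at h
  convert! h using 5 with ω
  rw [Finset.sum_sub_distrib, smul_sub, batchGrad]
  congr 1
  simp [← Nat.cast_smul_eq_nsmul ℝ, smul_smul, inv_mul_cancel₀ hb]

/-- The mean stochastic gradient, a measurable version of `∇f₀` on `D`. -/
theorem IsOracle.measurable_mean (hF : IsOracle F P f₀ D σ) :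
    Measurable fun p => ∫ s, stochGrad F p s ∂P :=
  (hF.measurable_grad.stronglyMeasurable.integral_prod_right (f := stochGrad F)).measurable

theorem IsSampling.measurable_error (hξ : IsSampling μ P b ξ) (hF : IsOracle F P f₀ D σ)
    (k : ℕ) {X : Ω → Vec d} (hX : Measurable X) (hXD : ∀ ω, X ω ∈ D) :
    Measurable fun ω => batchGrad F b ξ k (X ω) ω - gradient f₀ (X ω) := by
  -- Since `X` takes values in `D`, unbiasedness turns the true gradient into a parametric integral,
  -- whose measurability is known.
  have h : (fun ω => gradient f₀ (X ω)) = fun ω => ∫ s, stochGrad F (X ω) s ∂P :=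
    funext fun ω => (hF.unbiased _ (hXD ω)).symm
  refine Measurable.sub ?_ (h ▸ hF.measurable_mean.comp hX)
  have hs : Measurable fun ω => ∑ i : Fin (b k), stochGrad F (X ω) (ξ k i ω) :=
    Finset.measurable_fun_sum _ fun i _ =>
      hF.measurable_grad.comp (hX.prodMk (hξ.measurable k i))
  exact hs.const_smul ((b k : ℝ)⁻¹)

/-- Variance of the minibatch gradient at a random point depending on the past. -/
theorem IsSampling.lintegral_error_le [IsProbabilityMeasure μ] (hξ : IsSampling μ P b ξ) (hF : IsOracle F P f₀ D σ)
    (k : ℕ) {X : Ω → Vec d} (hX : Measurable[pastSigma b ξ k] X) (hXD : ∀ ω, X ω ∈ D) :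
    ∫⁻ ω, ENNReal.ofReal (‖batchGrad F b ξ k (X ω) ω - gradient f₀ (X ω)‖ ^ 2) ∂μ ≤
      ENNReal.ofReal (σ ^ 2 * (b k : ℝ)⁻¹) := by
  have hXm : Measurable X := hX.mono (hξ.pastSigma_le k) le_rfl
  have hBm : Measurable fun ω (i : Fin (b k)) => ξ k i ω :=
    measurable_pi_iff.2 fun i => hξ.measurable k i
  set H : Vec d × (Fin (b k) → S) → ENNReal := fun q => ENNReal.ofReal
    (‖(b k : ℝ)⁻¹ • ∑ i, stochGrad F q.1 (q.2 i) - ∫ s, stochGrad F q.1 s ∂P‖ ^ 2) with hH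
  have hHm : Measurable H := by
    refine ENNReal.measurable_ofReal.comp (Measurable.pow_const (Measurable.norm ?_) 2)
    refine Measurable.sub ?_ (hF.measurable_mean.comp measurable_fst)
    have hs : Measurable fun q : Vec d × (Fin (b k) → S) => ∑ i, stochGrad F q.1 (q.2 i) :=
      Finset.measurable_fun_sum _ fun i _ => hF.measurable_grad.comp
        (measurable_fst.prodMk ((measurable_pi_apply i).comp measurable_snd))
    exact hs.const_smul ((b k : ℝ)⁻¹)
  have hHe : ∀ p ∈ D, ∀ ω, H (p, fun i => ξ k i ω) =
      ENNReal.ofReal (‖batchGrad F b ξ k p ω - gradient f₀ p‖ ^ 2) := fun p hp ω => by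
    simp only [hH, hF.unbiased p hp, batchGrad]
  -- The joint law of the point and the batch is a product, so Tonelli freezes the point and the
  -- deterministic variance bound applies to the inner integral.
  have hprod := (indepFun_iff_map_prod_eq_prod_map_map hXm.aemeasurable hBm.aemeasurable).1
    (hξ.indepFun_past hX)
  have := Measure.isProbabilityMeasure_map (μ := μ) hBm.aemeasurable
  calc ∫⁻ ω, ENNReal.ofReal (‖batchGrad F b ξ k (X ω) ω - gradient f₀ (X ω)‖ ^ 2) ∂μ
      = ∫⁻ ω, H (X ω, fun i => ξ k i ω) ∂μ := lintegral_congr fun ω => (hHe _ (hXD ω) ω).symm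
    _ = ∫⁻ q, H q ∂((Measure.map X μ).prod (Measure.map (fun ω i => ξ k i ω) μ)) := by
        rw [← hprod, lintegral_map hHm (hXm.prodMk hBm)]
    _ = ∫⁻ ω', ∫⁻ s, H (X ω', s) ∂(Measure.map (fun ω i => ξ k i ω) μ) ∂μ := by
        rw [lintegral_prod _ hHm.aemeasurable, lintegral_map hHm.lintegral_prod_right' hXm]
    _ ≤ ∫⁻ _, ENNReal.ofReal (σ ^ 2 * (b k : ℝ)⁻¹) ∂μ := by
        refine lintegral_mono fun ω' => ?_
        rw [lintegral_map (f := fun s => H (X ω', s)) (hHm.comp measurable_prodMk_left) hBm]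
        simp only [hHe _ (hXD ω')]
        exact hξ.lintegral_batchGrad_le hF k (hXD ω')
    _ = ENNReal.ofReal (σ ^ 2 * (b k : ℝ)⁻¹) := by simp

/-- The gradient errors are almost surely square summable. -/
theorem IsSampling.ae_summable_error [IsProbabilityMeasure μ] (hξ : IsSampling μ P b ξ) (hF : IsOracle F P f₀ D σ)
    (hb : Summable fun k => ((b k : ℝ))⁻¹) {x : ℕ → Ω → Vec d}
    (hx : ∀ k, Measurable[pastSigma b ξ k] (x k)) (hxD : ∀ k ω, x k ω ∈ D) :
    ∀ᵐ ω ∂μ, Summable fun k =>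
      ‖batchGrad F b ξ k (x k ω) ω - gradient f₀ (x k ω)‖ ^ 2 := by
  have hm : ∀ k, Measurable fun ω => ENNReal.ofReal
      (‖batchGrad F b ξ k (x k ω) ω - gradient f₀ (x k ω)‖ ^ 2) := fun k =>
    ENNReal.measurable_ofReal.comp ((hξ.measurable_error hF k
      ((hx k).mono (hξ.pastSigma_le k) le_rfl) (hxD k)).norm.pow_const 2)
  -- The expected total error is at most `σ ^ 2` times the sum of the inverse batch sizes; a finite
  -- expectation forces almost sure finiteness.
  have hfin : ∫⁻ ω, ∑' k, ENNReal.ofReal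
      (‖batchGrad F b ξ k (x k ω) ω - gradient f₀ (x k ω)‖ ^ 2) ∂μ ≠ ⊤ := by
    rw [lintegral_tsum fun k => (hm k).aemeasurable]
    refine ne_top_of_le_ne_top ?_
      (ENNReal.tsum_le_tsum fun k => hξ.lintegral_error_le hF k (hx k) (hxD k))
    exact (hb.mul_left (σ ^ 2)).tsum_ofReal_ne_top
  filter_upwards [ae_lt_top (Measurable.tsum hm) hfin] with ω hω
  simpa [ENNReal.toReal_ofReal] using ENNReal.summable_toReal hω.ne

end Sampling

end LevelConstrained

end

/-! ### Assembly of the almost sure statements. -/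

theorem mainTheorem4 {d m : ℕ} (Q : LevelConstrained.Problem d m) (hQ : Q.Regular)
    {S : Type*} [MeasurableSpace S] (P : Measure S) [IsProbabilityMeasure P]
    (F : LevelConstrained.Vec d → S → ℝ) (σ : ℝ)
    (hF : LevelConstrained.IsOracle F P Q.f₀ Q.dom σ)
    {Ω : Type*} [MeasurableSpace Ω] (μ : Measure Ω) [IsProbabilityMeasure μ]
    (b : ℕ → ℕ) (ξ : (k : ℕ) → Fin (b k) → Ω → S)
    (hξ : LevelConstrained.IsSampling μ P b ξ)
    (x₀ : LevelConstrained.Vec d) (e δ : ℕ → Fin m → ℝ)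
    (he : LevelConstrained.IsLevelSchedule Q x₀ e δ)
    (γ β : ℕ → ℝ) (hβ : ∃ β₀ : ℝ, 0 < β₀ ∧ ∀ k, β₀ ≤ β k)
    (hγβ : ∀ k, 0 < 2 * γ k - β k - Q.L₀)
    (x : ℕ → Ω → LevelConstrained.Vec d)
    (hx : LevelConstrained.IsLCSPG Q F b ξ γ e x₀ x)
    (hb : Summable (fun k => ((b k : ℝ))⁻¹)) :
    (∀ᵐ ω ∂μ, Tendsto (fun k => ‖x (k + 1) ω - x k ω‖) atTop (𝓝 0)) ∧
    (Q.UniformMFCQ → (∃ Γ : ℝ, ∀ k, γ k ≤ Γ) →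
      (∀ᵐ ω ∂μ,
        (∀ k, ∃ l : LevelConstrained.Vec m,
          Q.IsSubMultiplier (LevelConstrained.batchGrad F b ξ k (x k ω) ω) (γ k) (e k)
            (x k ω) (x (k + 1) ω) l) ∧
        ∀ l : ℕ → LevelConstrained.Vec m,
          (∀ k, Q.IsSubMultiplier (LevelConstrained.batchGrad F b ξ k (x k ω) ω) (γ k) (e k)
            (x k ω) (x (k + 1) ω) (l k)) →
          ∃ B : ℝ, ∀ k, ‖l k‖ ≤ B) ∧
      (∀ᵐ ω ∂μ, ∀ y : LevelConstrained.Vec d,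
        MapClusterPt y atTop (fun k => x k ω) → Q.IsKKT y)) := by
  obtain ⟨β₀, hβ₀, hβ⟩ := hβ
  have hγ : ∀ k, β₀ + Q.L₀ ≤ 2 * γ k := fun k => by linarith [hβ k, hγβ k]
  have hγ0 : ∀ k, 0 ≤ γ k := fun k => by linarith [hγ k, hQ.f₀_smooth.1]
  have hfeas : ∀ k ω, x k ω ∈ Q.dom ∧ ∀ i, Q.ψ i (x k ω) < e k i := fun k ω =>
    hQ.strictly_feasible he (x := fun k => x k ω) (hx.init ω) (fun k => hx.step k ω) k
  have hsum := hξ.ae_summable_error hF hb hx.adapted fun k ω => (hfeas k ω).1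
  have hstep : ∀ᵐ ω ∂μ, Tendsto (fun k => ‖x (k + 1) ω - x k ω‖) atTop (𝓝 0) := by
    filter_upwards [hsum] with ω hω
    exact hQ.tendsto_step he (x := fun k => x k ω) (hx.init ω) (fun k => hx.step k ω) hβ₀ hγ hω
  have hG : ∀ᵐ ω ∂μ, Tendsto (fun k => LevelConstrained.batchGrad F b ξ k (x k ω) ω -
      gradient Q.f₀ (x k ω)) atTop (𝓝 0) := by
    filter_upwards [hsum] with ω hω
    rw [tendsto_zero_iff_norm_tendsto_zero]
    simpa using hω.tendsto_atTop_zero.sqrt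
  -- Existence needs no exceptional null set: strict feasibility of the iterates holds on every
  -- path.
  have hex : ∀ ω k, ∃ l : LevelConstrained.Vec m,
      Q.IsSubMultiplier (LevelConstrained.batchGrad F b ξ k (x k ω) ω) (γ k) (e k)
        (x k ω) (x (k + 1) ω) l := fun ω k =>
    hQ.exists_isSubMultiplier (hγ0 k) (hfeas k ω).1 (hfeas k ω).2 (hx.step k ω)
  refine ⟨hstep, fun hm ⟨Γ, hΓ⟩ => ?_⟩
  -- The exceptional set is fixed by the steps and the gradient errors alone, so all choices of
  -- multipliers are handled on the same event.
  have hbdd : ∀ᵐ ω ∂μ, ∀ l : ℕ → LevelConstrained.Vec m,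
      (∀ k, Q.IsSubMultiplier (LevelConstrained.batchGrad F b ξ k (x k ω) ω) (γ k) (e k)
        (x k ω) (x (k + 1) ω) (l k)) → ∃ B : ℝ, ∀ k, ‖l k‖ ≤ B := by
    filter_upwards [hstep, hG] with ω h1 h2 l hl
    exact hQ.multipliers_bounded hm he (x := fun k => x k ω) (hx.init ω)
      (fun k => hx.step k ω) hγ0 hΓ h1 h2 hl
  refine ⟨?_, ?_⟩
  · filter_upwards [hbdd] with ω h
    exact ⟨hex ω, h⟩
  · filter_upwards [hstep, hG, hbdd] with ω h1 h2 h3 y hy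
    choose l hl using hex ω
    obtain ⟨B, hB⟩ := h3 l hl
    exact hQ.isKKT_of_mapClusterPt he (x := fun k => x k ω) (hx.init ω)
      (fun k => hx.step k ω) hγ0 hΓ h1 h2 hl hB hy
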